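/- **Processes.** Let $\mathbf{Var}$ be a countably infinite set of variables and $\Lambda$ a set of access labels $\xi$. Values are $v ::= x \mid \mathbf{true}\mid\mathbf{false}$. A trace set $\Phi\subseteq\Lambda^*$ is a prefix-closed set of sequences of access labels, and $\Phi^{-\xi}=\{s \mid \xi s\in\Phi\}$. Processes, up to renaming of bound variables, are $$P ::= \mathbf 0 \mid \overline{x}\langle \tilde v\rangle.P \mid x(\tilde y).P \mid P|Q \mid \mathbf{if}\ v\ \mathbf{then}\ P\ \mathbf{else}\ Q \mid (\nu x)P \mid {*}P \mid \mathbf{acc}_\xi(x).P \mid (\mathfrak N x{:}\Phi)P ,$$ where $(\mathfrak N x{:}\Phi)P$ creates a resource $x$ that is to be accessed according to $\Phi$. $P$ is *safe* if it has no subterm $(\mathfrak N x{:}\emptyset)Q$. **Reduction.** The structural preorder $\preceq$ is the least preorder closed under $|$, $(\nu x)$ and $(\mathfrak N x{:}\Phi)$ that contains, in both directions, $P|\mathbf 0\preceq P$, $P|Q\preceq Q|P$, $P|(Q|R)\preceq(P|Q)|R$, and, in this direction only, ${*}P\preceq {*}P|P$, $(\nu x)P|Q\preceq(\nu x)(P|Q)$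 and $(\mathfrak N x{:}\Phi)P|Q\preceq(\mathfrak N x{:}\Phi)(P|Q)$ for $x\notin\mathrm{FV}(Q)$. Reductions $P\xrightarrow{L}P'$, with $L$ either $x^\xi$ (target $\{x\}$) or $\tau$ (target $\emptyset$), are generated by: $\overline x\langle\tilde v\rangle.P\,|\,x(\tilde y).Q\xrightarrow{\tau}P\,|\,[\tilde v/\tilde y]Q$; $\mathbf{acc}_\xi(x).P\xrightarrow{x^\xi}P$; the two conditionals, with label $\tau$; closure under $\cdot|Q$ and under $\preceq$ on both sides; if $P\xrightarrow{L}P'$ and $x$ is not in the target of $L$, then $(\nu x)P\xrightarrow{L}(\nu x)P'$ and $(\mathfrak N x{:}\Phi)P\xrightarrow{L}(\mathfrak N x{:}\Phi)P'$; if $P\xrightarrow{x^\xi}P'$, then $(\mathfrak N x{:}\Phi)P\xrightarrow{\tau}(\mathfrak N x{:}\Phi^{-\xi})P'$. Finally $\to^*$ is the reflexive transitive closure of $\bigcup_L\xrightarrow{L}$. **Behavioral types.** $$A ::= \mathbf 0\mid x.A\mid\overline x.A\mid x^\xi.A\mid\tau.A\mid A|B\mid A\oplus B\mid {*}A\mid\langle\tilde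 v/\tilde x\rangle A\mid(\nu x)A\mid\alpha\mid\mu\alpha.A\mid A{\uparrow}_S\mid A{\downarrow}_S\qquad(S\text{ a finite set of variables}).$$ Free variables are as usual, with $\mathrm{FV}(\langle\tilde v/\tilde x\rangle A)=(\mathrm{FV}(A)\setminus\tilde x)\cup\mathrm{FV}(\tilde v)$, $\mathrm{FV}(A{\uparrow}_S)=\mathrm{FV}(A)\setminus S$ and $\mathrm{FV}(A{\downarrow}_S)=\mathrm{FV}(A)\cap S$. Labels are $l::=x\mid\overline x\mid x^\xi\mid\tau\mid\{x,\overline y\}$, with the evident targets. Prefixes perform their action. In $A|B$ each side moves alone, and an input $x$ of one side and an output $\overline y$ of the other combine to $\{x,\overline y\}$. Any transition labelled $\{x,\overline x\}$ is also a $\tau$-transition. $A\oplus B$ has the transitions of $A$ and those of $B$. ${*}A$ has those of $A|{*}A$, and $\mu\alpha.A$ those of $[\mu\alpha.A/\alpha]A$. $\langle\tilde v/\tilde x\rangle A$ applies the simultaneous substitution to the labels of $A$. $(\nu x)A$ keeps the transitions whose target does not contain $x$. $A{\uparrow}_S$ keeps labels whose target is disjoint from $S$ and turns labels whose target is contained in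 $S$ into $\tau$. $A{\downarrow}_S$ keeps labels whose target is contained in $S$ and turns labels whose target is disjoint from $S$ into $\tau$. Let $\Rightarrow$ be $(\xrightarrow{\tau})^*$; let $\overset{l}{\Rightarrow}$ be $\Rightarrow\xrightarrow{l}\Rightarrow$ for $l\ne\tau$, and $\Rightarrow$ for $l=\tau$. Subtyping $A\le B$ is the largest relation such that $A\le B$ and $A\xrightarrow{l}A'$ imply $B\overset{l}{\Rightarrow}B'$ and $A'\le B'$ for some $B'$. Finally $$\mathrm{traces}_x(A)=\{\xi_1\cdots\xi_n \mid A{\downarrow}_{\{x\}}\overset{x^{\xi_1}}{\Longrightarrow}\cdots\overset{x^{\xi_n}}{\Longrightarrow}\}.$$ **Typing.** Types are $\sigma::=\mathbf{bool}\mid\mathbf{res}\mid\mathbf{chan}\langle(\tilde y{:}\tilde\sigma)A\rangle$ with $\mathrm{FV}(A)\subseteq\tilde y$, up to renaming of $\tilde y$. An environment $\Gamma$ is a partial map from variables to types; $\Gamma\triangleright x:\Gamma(x)$ and $\Gamma\triangleright\mathbf{true},\mathbf{false}:\mathbf{bool}$. The judgment $\Gamma\triangleright P:A$ is generated by the following rules,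 where bound variables are chosen fresh. - $\Gamma\triangleright\mathbf 0:\mathbf 0$. - If $\Gamma\triangleright P:A_2$, $\Gamma\triangleright x:\mathbf{chan}\langle(\tilde y{:}\tilde\sigma)A_1\rangle$ and $\Gamma\triangleright\tilde v:\tilde\sigma$, then $\Gamma\triangleright\overline x\langle\tilde v\rangle.P:\overline x.(\langle\tilde v/\tilde y\rangle A_1\,|\,A_2)$. - If $\Gamma,\tilde y{:}\tilde\sigma\triangleright P:A_2$, $\Gamma\triangleright x:\mathbf{chan}\langle(\tilde y{:}\tilde\sigma)A_1\rangle$ and $A_2{\downarrow}_{\tilde y}\le A_1$, then $\Gamma\triangleright x(\tilde y).P:x.(A_2{\uparrow}_{\tilde y})$. - If $\Gamma\triangleright P:A$ and $\Gamma\triangleright Q:B$, then $\Gamma\triangleright P|Q:A|B$. If $\Gamma\triangleright P:A$, then $\Gamma\triangleright{*}P:{*}A$. - If $\Gamma\triangleright v:\mathbf{bool}$, $\Gamma\triangleright P:A$ and $\Gamma\triangleright Q:A$, then $\Gamma\triangleright\mathbf{if}\ v\ \mathbf{then}\ P\ \mathbf{else}\ Q:A$. - If $\Gamma,x{:}\mathbf{chan}\langle(\tilde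 y{:}\tilde\sigma)A_1\rangle\triangleright P:A$, then $\Gamma\triangleright(\nu x)P:(\nu x)A$. - If $\Gamma\triangleright P:A$ and $\Gamma\triangleright x:\mathbf{res}$, then $\Gamma\triangleright\mathbf{acc}_\xi(x).P:x^\xi.A$. - If $\Gamma,x{:}\mathbf{res}\triangleright P:A$ and $\mathrm{traces}_x(A)\subseteq\Phi$, then $\Gamma\triangleright(\mathfrak N x{:}\Phi)P:A{\uparrow}_{\{x\}}$. - If $\Gamma\triangleright P:A'$ and $A'\le A$, then $\Gamma\triangleright P:A$. **Theorem.** If $P$ is safe, $\Gamma\triangleright P:A$ and $P\to^*P'$, then $P'$ is safe. -/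

import Mathlib

namespace ResPi

universe u

/-! # Names, values, trace sets -/

/-- The countably infinite set of variables. -/
abbrev Var : Type := ℕ

/-- Values: variables and the two boolean constants. -/
inductive Val : Type
  | var (x : Var)
  | bool (b : Bool)

/-- A trace set: a prefix-closed set of sequences of access labels. -/
structure TraceSet (Λ : Type u) : Type u where
  carrier : Set (List Λ)
  prefix_closed : ∀ s t : List Λ, s ++ t ∈ carrier → s ∈ carrier

/-- The residual `Φ^{-ξ} = {s | ξ s ∈ Φ}`. -/
def TraceSet.residual {Λ : Type u} (Φ : TraceSet Λ) (ξ : Λ) : TraceSet Λ where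
  carrier := {s | ξ :: s ∈ Φ.carrier}
  prefix_closed := fun s t h => Φ.prefix_closed (ξ :: s) t h

/-- The residual is empty exactly when the access `ξ` is not allowed by `Φ`. -/
theorem TraceSet.residual_empty_iff {Λ : Type u} (Φ : TraceSet Λ) (ξ : Λ) :
    (Φ.residual ξ).carrier = ∅ ↔ [ξ] ∉ Φ.carrier := by
  constructor
  · intro h h'
    have h2 : ([] : List Λ) ∈ (Φ.residual ξ).carrier := h'
    rw [h] at h2
    exact h2
  · intro h
    ext s
    constructor
    · intro hs
      exact absurd (Φ.prefix_closed [ξ] s hs) h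
    · intro hs
      exact hs.elim

/-! # Processes

Processes are identified up to renaming of bound variables. This is obtained by the locally
nameless representation: free variables are names, and `bvar i j` stands for the `j`-th variable
bound by the `i`-th enclosing binder. Every binder is a tuple binder; the two restrictions bind
one variable, an input binds as many as it receives. -/

/-- An occurrence of a value, or of a bound variable, in a process. -/
inductive Occ : Type
  | val (v : Val)
  | bvar (i j : ℕ)

/-- Processes, with access labels in `Λ`.
* `nil` : `0`
* `out x vs P` : `x̄⟨vs⟩.P`
* `inp x n P` : `x(y₁,…,yₙ).P`
* `par P Q` : `P | Q`
* `ite v P Q` : `if v then P else Q`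
* `nu P` : `(νx)P`
* `rep P` : `*P`
* `acc ξ x P` : `acc_ξ(x).P`
* `nuR Φ P` : `(𝔑x : Φ)P`, creation of a resource `x` to be used according to `Φ`. -/
inductive Proc (Λ : Type u) : Type u
  | nil : Proc Λ
  | out (x : Occ) (vs : List Occ) (P : Proc Λ) : Proc Λ
  | inp (x : Occ) (n : ℕ) (P : Proc Λ) : Proc Λ
  | par (P Q : Proc Λ) : Proc Λ
  | ite (v : Occ) (P Q : Proc Λ) : Proc Λ
  | nu (P : Proc Λ) : Proc Λ
  | rep (P : Proc Λ) : Proc Λ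
  | acc (ξ : Λ) (x : Occ) (P : Proc Λ) : Proc Λ
  | nuR (Φ : TraceSet Λ) (P : Proc Λ) : Proc Λ

/-- The occurrence of a variable. -/
abbrev Occ.var (x : Var) : Occ := Occ.val (Val.var x)

def Val.fv : Val → Finset Var
  | .var x => {x}
  | .bool _ => ∅

def Occ.fv : Occ → Finset Var
  | .val v => v.fv
  | .bvar _ _ => ∅

/-- Replace the variables bound by the `k`-th enclosing binder by the values `vs`. -/
def Occ.inst (k : ℕ) (vs : List Val) : Occ → Occ
  | .val v => .val v
  | .bvar i j =>
    if i = k then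
      match vs[j]? with
      | some v => .val v
      | none => .bvar i j
    else .bvar i j

/-- `ctx` lists the arities of the enclosing binders, innermost first. -/
def Occ.LCAt (ctx : List ℕ) : Occ → Prop
  | .val _ => True
  | .bvar i j => ∃ n, ctx[i]? = some n ∧ j < n

namespace Proc

variable {Λ : Type u}

/-- Free variables. -/
def fv : Proc Λ → Finset Var
  | nil => ∅
  | out x vs P => x.fv ∪ (vs.foldr (fun v s => v.fv ∪ s) ∅) ∪ P.fv
  | inp x _ P => x.fv ∪ P.fv
  | par P Q => P.fv ∪ Q.fv
  | ite v P Q => v.fv ∪ P.fv ∪ Q.fv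
  | nu P => P.fv
  | rep P => P.fv
  | acc _ x P => x.fv ∪ P.fv
  | nuR _ P => P.fv

/-- Replace the variables bound by the `k`-th enclosing binder by the values `vs`. -/
def inst (k : ℕ) (vs : List Val) : Proc Λ → Proc Λ
  | nil => nil
  | out x ws P => out (x.inst k vs) (ws.map (Occ.inst k vs)) (P.inst k vs)
  | inp x n P => inp (x.inst k vs) n (P.inst (k + 1) vs)
  | par P Q => par (P.inst k vs) (Q.inst k vs)
  | ite v P Q => ite (v.inst k vs) (P.inst k vs) (Q.inst k vs)
  | nu P => nu (P.inst (k + 1) vs)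
  | rep P => rep (P.inst k vs)
  | acc ξ x P => acc ξ (x.inst k vs) (P.inst k vs)
  | nuR Φ P => nuR Φ (P.inst (k + 1) vs)

/-- The substitution `[vs/ys]P`, where `P` is the body of a binder of `ys`. -/
def bind (P : Proc Λ) (vs : List Val) : Proc Λ := P.inst 0 vs

/-- The body of a binder, with the bound variables called `ys`. -/
def withNames (P : Proc Λ) (ys : List Var) : Proc Λ := P.bind (ys.map Val.var)

/-- All bound variables are bound by one of the enclosing binders, whose arities are in `ctx`. -/
def LCAt : List ℕ → Proc Λ → Prop
  | _, nil => True
  | c, out x vs P => x.LCAt c ∧ (∀ v ∈ vs, Occ.LCAt c v) ∧ P.LCAt c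
  | c, inp x n P => x.LCAt c ∧ P.LCAt (n :: c)
  | c, par P Q => P.LCAt c ∧ Q.LCAt c
  | c, ite v P Q => v.LCAt c ∧ P.LCAt c ∧ Q.LCAt c
  | c, nu P => P.LCAt (1 :: c)
  | c, rep P => P.LCAt c
  | c, acc _ x P => x.LCAt c ∧ P.LCAt c
  | c, nuR _ P => P.LCAt (1 :: c)

/-- No dangling bound variables: the term represents a genuine process. -/
def LC (P : Proc Λ) : Prop := P.LCAt []

/-- A process is safe if it has no subterm `(𝔑x : Φ)Q` with `Φ = ∅`. -/
def Safe : Proc Λ → Prop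
  | nil => True
  | out _ _ P => P.Safe
  | inp _ _ P => P.Safe
  | par P Q => P.Safe ∧ Q.Safe
  | ite _ P Q => P.Safe ∧ Q.Safe
  | nu P => P.Safe
  | rep P => P.Safe
  | acc _ _ P => P.Safe
  | nuR Φ P => Φ.carrier ≠ ∅ ∧ P.Safe

end Proc

/-! # Operational semantics of processes -/

/-- The structural preorder `P ⪯ Q`. In the scope extrusion rules, the variable bound in `P` does
not occur in `Q`, because `Q` has no dangling bound variable. -/
inductive SP {Λ : Type u} : Proc Λ → Proc Λ → Prop
  | refl (P) : SP P P
  | trans {P Q R} : SP P Q → SP Q R → SP P R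
  | zero (P) : SP (.par P .nil) P
  | zero' (P) : SP P (.par P .nil)
  | commut (P Q) : SP (.par P Q) (.par Q P)
  | assoc (P Q R) : SP (.par P (.par Q R)) (.par (.par P Q) R)
  | assoc' (P Q R) : SP (.par (.par P Q) R) (.par P (.par Q R))
  | rep (P) : SP (.rep P) (.par (.rep P) P)
  | new (P Q) : Q.LC → SP (.par (.nu P) Q) (.nu (.par P Q))
  | newR (Φ P Q) : Q.LC → SP (.par (.nuR Φ P) Q) (.nuR Φ (.par P Q))
  | par {P P' Q Q'} : SP P P' → SP Q Q' → SP (.par P Q) (.par P' Q')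
  | cNew {P Q} (x : Var) : x ∉ P.fv → x ∉ Q.fv →
      SP (P.withNames [x]) (Q.withNames [x]) → SP (.nu P) (.nu Q)
  | cNewR {P Q} (Φ) (x : Var) : x ∉ P.fv → x ∉ Q.fv →
      SP (P.withNames [x]) (Q.withNames [x]) → SP (.nuR Φ P) (.nuR Φ Q)

/-- Labels of the reduction relation: an access `x^ξ`, or the silent label. -/
inductive RLab (Λ : Type u) : Type u
  | acc (x : Var) (ξ : Λ)
  | tau

def RLab.target {Λ : Type u} : RLab Λ → Set Var
  | .acc x _ => {x}
  | .tau => ∅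

/-- The labelled reduction relation. -/
inductive Red {Λ : Type u} : Proc Λ → RLab Λ → Proc Λ → Prop
  | com (x : Var) (vs : List Val) (P Q) :
      Red (.par (.out (.var x) (vs.map Occ.val) P) (.inp (.var x) vs.length Q)) .tau
        (.par P (Q.bind vs))
  | acc (ξ) (x : Var) (P) : Red (.acc ξ (.var x) P) (.acc x ξ) P
  | par {P L P'} (Q) : Red P L P' → Red (.par P Q) L (.par P' Q)
  | new {P L Q} (x : Var) : x ∉ P.fv → x ∉ Q.fv → x ∉ L.target →
      Red (P.withNames [x]) L (Q.withNames [x]) → Red (.nu P) L (.nu Q)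
  | newR1 {P Q} (Φ) (x : Var) (ξ) : x ∉ P.fv → x ∉ Q.fv →
      Red (P.withNames [x]) (.acc x ξ) (Q.withNames [x]) →
      Red (.nuR Φ P) .tau (.nuR (Φ.residual ξ) Q)
  | newR2 {P L Q} (Φ) (x : Var) : x ∉ P.fv → x ∉ Q.fv → x ∉ L.target →
      Red (P.withNames [x]) L (Q.withNames [x]) → Red (.nuR Φ P) L (.nuR Φ Q)
  | ifT (P Q) : Red (.ite (.val (.bool true)) P Q) .tau P
  | ifF (P Q) : Red (.ite (.val (.bool false)) P Q) .tau Q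
  | sp {P P' L Q' Q} : SP P P' → Red P' L Q' → SP Q' Q → Red P L Q

/-- `P → Q` : a reduction step with any label. -/
def Step {Λ : Type u} (P Q : Proc Λ) : Prop := ∃ L, Red P L Q

/-- `P →* Q`. -/
def Steps {Λ : Type u} : Proc Λ → Proc Λ → Prop := Relation.ReflTransGen Step

/-! # Behavioral types -/

/-- A simultaneous renaming `⟨v₁,…,vₙ/x₁,…,xₙ⟩`, as the list of the pairs `(xᵢ, vᵢ)`. -/
abbrev Ren : Type := List (Var × Val)

/-- Behavioral types.
* `nil` : `0`
* `inp x A`, `out x A`, `acc ξ x A`, `tau A` : `x.A`, `x̄.A`, `x^ξ.A`, `τ.A`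
* `par A B`, `choice A B`, `rep A` : `A | B`, `A ⊕ B`, `*A`
* `ren θ A` : `⟨ỹ/x̃⟩A`
* `nu x A` : `(νx)A`
* `tvar n`, `mu A` : type variables and recursive types `μα.A`, with de Bruijn indices for `α`
* `excl A S` : `A↑_S`, the actions on `S` are made silent
* `proj A S` : `A↓_S`, the actions outside `S` are made silent. -/
inductive Beh (Λ : Type u) : Type u
  | nil : Beh Λ
  | inp (x : Var) (A : Beh Λ) : Beh Λ
  | out (x : Var) (A : Beh Λ) : Beh Λ
  | acc (ξ : Λ) (x : Var) (A : Beh Λ) : Beh Λ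
  | tau (A : Beh Λ) : Beh Λ
  | par (A B : Beh Λ) : Beh Λ
  | choice (A B : Beh Λ) : Beh Λ
  | rep (A : Beh Λ) : Beh Λ
  | ren (θ : Ren) (A : Beh Λ) : Beh Λ
  | nu (x : Var) (A : Beh Λ) : Beh Λ
  | tvar (n : ℕ) : Beh Λ
  | mu (A : Beh Λ) : Beh Λ
  | excl (A : Beh Λ) (S : Finset Var) : Beh Λ
  | proj (A : Beh Λ) (S : Finset Var) : Beh Λ

/-- The variables `x̃` that `⟨ỹ/x̃⟩` replaces. -/
def Ren.dom (θ : Ren) : Finset Var := (θ.map Prod.fst).toFinset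

/-- The variables among the values `ỹ` of `⟨ỹ/x̃⟩`. -/
def Ren.rangeVars (θ : Ren) : Finset Var := θ.foldr (fun p s => p.2.fv ∪ s) ∅

/-- The action of a renaming on values. -/
def Val.ren (θ : Ren) : Val → Val
  | .var x => (θ.lookup x).getD (.var x)
  | .bool b => .bool b

def Val.perm (π : Equiv.Perm Var) : Val → Val
  | .var x => .var (π x)
  | .bool b => .bool b

namespace Beh

variable {Λ : Type u}

/-- Free variables. -/
def fv : Beh Λ → Finset Var
  | nil => ∅
  | inp x A => {x} ∪ A.fv
  | out x A => {x} ∪ A.fv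
  | acc _ x A => {x} ∪ A.fv
  | tau A => A.fv
  | par A B => A.fv ∪ B.fv
  | choice A B => A.fv ∪ B.fv
  | rep A => A.fv
  | ren θ A => (A.fv \ θ.dom) ∪ θ.rangeVars
  | nu x A => A.fv \ {x}
  | tvar _ => ∅
  | mu A => A.fv
  | excl A S => A.fv \ S
  | proj A S => A.fv ∩ S

/-- All variables that are written in a behavioral type, free or not. -/
def vars : Beh Λ → Finset Var
  | nil => ∅
  | inp x A => {x} ∪ A.vars
  | out x A => {x} ∪ A.vars
  | acc _ x A => {x} ∪ A.vars
  | tau A => A.vars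
  | par A B => A.vars ∪ B.vars
  | choice A B => A.vars ∪ B.vars
  | rep A => A.vars
  | ren θ A => A.vars ∪ θ.dom ∪ θ.rangeVars
  | nu x A => A.vars ∪ {x}
  | tvar _ => ∅
  | mu A => A.vars
  | excl A S => A.vars ∪ S
  | proj A S => A.vars ∪ S

/-- Apply a permutation to all variables. -/
def perm (π : Equiv.Perm Var) : Beh Λ → Beh Λ
  | nil => nil
  | inp x A => inp (π x) (A.perm π)
  | out x A => out (π x) (A.perm π)
  | acc ξ x A => acc ξ (π x) (A.perm π)
  | tau A => tau (A.perm π)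
  | par A B => par (A.perm π) (B.perm π)
  | choice A B => choice (A.perm π) (B.perm π)
  | rep A => rep (A.perm π)
  | ren θ A => ren (θ.map (fun p => (π p.1, p.2.perm π))) (A.perm π)
  | nu x A => nu (π x) (A.perm π)
  | tvar n => tvar n
  | mu A => mu (A.perm π)
  | excl A S => excl (A.perm π) (S.map π.toEmbedding)
  | proj A S => proj (A.perm π) (S.map π.toEmbedding)

/-- Increase the type variables with index at least `c`. -/
def lift (c : ℕ) : Beh Λ → Beh Λ
  | nil => nil
  | inp x A => inp x (A.lift c)
  | out x A => out x (A.lift c)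
  | acc ξ x A => acc ξ x (A.lift c)
  | tau A => tau (A.lift c)
  | par A B => par (A.lift c) (B.lift c)
  | choice A B => choice (A.lift c) (B.lift c)
  | rep A => rep (A.lift c)
  | ren θ A => ren θ (A.lift c)
  | nu x A => nu x (A.lift c)
  | tvar n => if n < c then tvar n else tvar (n + 1)
  | mu A => mu (A.lift (c + 1))
  | excl A S => excl (A.lift c) S
  | proj A S => proj (A.lift c) S

end Beh

/-- `TSubst C k A B` : `B` is `[C/α]A`, where `α` is the type variable with index `k`. The
substitution avoids capture: the variable bound by a `ν` is first renamed to a variable `z` that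
is not free in `C`. Renaming `⟨ỹ/x̃⟩`, exclusion and projection are operators on behaviors, not
binders, and apply to the substituted type. -/
inductive TSubst {Λ : Type u} : Beh Λ → ℕ → Beh Λ → Beh Λ → Prop
  | nil {C k} : TSubst C k .nil .nil
  | inp {C k A B} (x) : TSubst C k A B → TSubst C k (.inp x A) (.inp x B)
  | out {C k A B} (x) : TSubst C k A B → TSubst C k (.out x A) (.out x B)
  | acc {C k A B} (ξ x) : TSubst C k A B → TSubst C k (.acc ξ x A) (.acc ξ x B)
  | tau {C k A B} : TSubst C k A B → TSubst C k (.tau A) (.tau B)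
  | par {C k A B A' B'} : TSubst C k A A' → TSubst C k B B' →
      TSubst C k (.par A B) (.par A' B')
  | choice {C k A B A' B'} : TSubst C k A A' → TSubst C k B B' →
      TSubst C k (.choice A B) (.choice A' B')
  | rep {C k A B} : TSubst C k A B → TSubst C k (.rep A) (.rep B)
  | ren {C k A B} (θ) : TSubst C k A B → TSubst C k (.ren θ A) (.ren θ B)
  | nu {C k A B} (x z : Var) : z ∉ C.fv → (z = x ∨ z ∉ A.vars) →
      TSubst C k (A.perm (Equiv.swap x z)) B → TSubst C k (.nu x A) (.nu z B)
  | tvarEq {C k} : TSubst C k (.tvar k) C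
  | tvarLt {C k n} : n < k → TSubst C k (.tvar n) (.tvar n)
  | tvarGt {C k n} : k ≤ n → TSubst C k (.tvar (n + 1)) (.tvar n)
  | mu {C k A B} : TSubst (C.lift 0) (k + 1) A B → TSubst C k (.mu A) (.mu B)
  | excl {C k A B} (S) : TSubst C k A B → TSubst C k (.excl A S) (.excl B S)
  | proj {C k A B} (S) : TSubst C k A B → TSubst C k (.proj A S) (.proj B S)

/-- Transition labels of behavioral types: `x`, `x̄`, `x^ξ`, `τ` and `{x, ȳ}`. The last one is
the potential of a communication, if a renaming identifies `x` and `y`. Renaming a parameter to a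
boolean constant makes the constant the subject of the label. -/
inductive Lab (Λ : Type u) : Type u
  | inp (x : Val)
  | out (x : Val)
  | acc (x : Val) (ξ : Λ)
  | tau
  | com (x y : Val)

namespace Lab

variable {Λ : Type u}

def target : Lab Λ → Set Val
  | inp x => {x}
  | out x => {x}
  | acc x _ => {x}
  | tau => ∅
  | com x y => {x, y}

def ren (θ : Ren) : Lab Λ → Lab Λ
  | inp x => inp (x.ren θ)
  | out x => out (x.ren θ)
  | acc x ξ => acc (x.ren θ) ξ
  | tau => tau
  | com x y => com (x.ren θ) (y.ren θ)

end Lab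

/-- The values that are variables in `S`. -/
def varSet (S : Finset Var) : Set Val := Val.var '' (S : Set Var)

/-- The transition relation on behavioral types. -/
inductive Tr {Λ : Type u} : Beh Λ → Lab Λ → Beh Λ → Prop
  | inp (x A) : Tr (.inp x A) (.inp (.var x)) A
  | out (x A) : Tr (.out x A) (.out (.var x)) A
  | acc (ξ x A) : Tr (.acc ξ x A) (.acc (.var x) ξ) A
  | tau (A) : Tr (.tau A) .tau A
  | parL {A l A'} (B) : Tr A l A' → Tr (.par A B) l (.par A' B)
  | parR {B l B'} (A) : Tr B l B' → Tr (.par A B) l (.par A B')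
  | par2L {A B A' B' x y} : Tr A (.inp x) A' → Tr B (.out y) B' →
      Tr (.par A B) (.com x y) (.par A' B')
  | par2R {A B A' B' x y} : Tr A (.out y) A' → Tr B (.inp x) B' →
      Tr (.par A B) (.com x y) (.par A' B')
  | com {A B x} : Tr A (.com x x) B → Tr A .tau B
  | choiceL {A l A'} (B) : Tr A l A' → Tr (.choice A B) l A'
  | choiceR {B l B'} (A) : Tr B l B' → Tr (.choice A B) l B'
  | rep {A l A'} : Tr (.par A (.rep A)) l A' → Tr (.rep A) l A'
  | mu {A B l A'} : TSubst (.mu A) 0 A B → Tr B l A' → Tr (.mu A) l A'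
  | ren {A l A'} (θ) : Tr A l A' → Tr (.ren θ A) (l.ren θ) (.ren θ A')
  | nu {A l A'} (x) : Tr A l A' → Disjoint l.target (varSet {x}) → Tr (.nu x A) l (.nu x A')
  | exclOut {A l A'} (S) : Tr A l A' → Disjoint l.target (varSet S) →
      Tr (.excl A S) l (.excl A' S)
  | exclIn {A l A'} (S) : Tr A l A' → l.target ⊆ varSet S → Tr (.excl A S) .tau (.excl A' S)
  | projOut {A l A'} (S) : Tr A l A' → Disjoint l.target (varSet S) →
      Tr (.proj A S) .tau (.proj A' S)
  | projIn {A l A'} (S) : Tr A l A' → l.target ⊆ varSet S → Tr (.proj A S) l (.proj A' S)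

/-- `A ⇒ B` : any number of silent transitions. -/
def Taus {Λ : Type u} : Beh Λ → Beh Λ → Prop :=
  Relation.ReflTransGen (fun A B => Tr A .tau B)

/-- The weak transition relation: `⇒` for `τ`, and `⇒ →ˡ ⇒` for any label `l`. -/
def WTr {Λ : Type u} (A : Beh Λ) (l : Lab Λ) (B : Beh Λ) : Prop :=
  (l = .tau ∧ Taus A B) ∨ ∃ A₁ B₁, Taus A A₁ ∧ Tr A₁ l B₁ ∧ Taus B₁ B

/-- `R A B` implies that `B` weakly simulates the transitions of `A`. -/
def IsSimulation {Λ : Type u} (R : Beh Λ → Beh Λ → Prop) : Prop :=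
  ∀ A B, R A B → ∀ l A', Tr A l A' → ∃ B', WTr B l B' ∧ R A' B'

/-- The subtyping relation `A ≤ B`, the largest simulation. -/
def Sub {Λ : Type u} (A B : Beh Λ) : Prop := ∃ R, IsSimulation R ∧ R A B

/-- `A` can perform weakly the accesses `x^ξ₁, …, x^ξₙ`. -/
def HasTrace {Λ : Type u} (x : Var) : Beh Λ → List Λ → Prop
  | _, [] => True
  | A, ξ :: s => ∃ B, WTr A (.acc (.var x) ξ) B ∧ HasTrace x B s

/-- `traces_x(A)`, the access sequences on `x` that `A↓_{x}` can perform. -/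
def traces {Λ : Type u} (x : Var) (A : Beh Λ) : Set (List Λ) :=
  {s | HasTrace x (.proj A {x}) s}

/-! # The type system -/

/-- Types: booleans, resources and channels. `chan n σ A` is the type `chan⟨(x₁:σ₁,…,xₙ:σₙ)A⟩`.
The bound parameters are called `0, …, n - 1`, which fixes one representative up to renaming of
bound variables; types have no free variables, so `A` mentions no other variable. -/
inductive Ty (Λ : Type u) : Type u
  | bool : Ty Λ
  | res : Ty Λ
  | chan (n : ℕ) (σ : Fin n → Ty Λ) (A : Beh Λ) (closed : A.fv ⊆ Finset.range n) : Ty Λ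

/-- The behavior `⟨v₁,…,vₙ/x₁,…,xₙ⟩A`, where `A` is the behavior in a channel type and the `xᵢ`
are its parameters. -/
def Beh.atArgs {Λ : Type u} (A : Beh Λ) (vs : List Val) : Beh Λ :=
  .ren ((List.range vs.length).zip vs) A

/-- Type environments. -/
abbrev Env (Λ : Type u) : Type u := Var → Option (Ty Λ)

/-- `Γ, x₁:σ₁, …, xₙ:σₙ`. -/
def Env.extend {Λ : Type u} (Γ : Env Λ) (xs : List Var) (σs : List (Ty Λ)) : Env Λ :=
  fun z => ((xs.zip σs).lookup z).or (Γ z)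

/-- `Γ ▷ v : σ`. -/
inductive HasTy {Λ : Type u} (Γ : Env Λ) : Val → Ty Λ → Prop
  | var {x σ} : Γ x = some σ → HasTy Γ (.var x) σ
  | bool (b) : HasTy Γ (.bool b) .bool

/-- The type judgment `Γ ▷ P : A`. In the rules for binders, the bound variables are given names
that do not occur free in the body. -/
inductive Typed {Λ : Type u} : Env Λ → Proc Λ → Beh Λ → Prop
  | zero {Γ} : Typed Γ .nil .nil
  | out {Γ x n σ A₁ hA₁ vs P A₂} : Typed Γ P A₂ →
      HasTy Γ (.var x) (.chan n σ A₁ hA₁) →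
      List.Forall₂ (HasTy Γ) vs (List.ofFn σ) →
      Typed Γ (.out (.var x) (vs.map Occ.val) P) (.out x (.par (A₁.atArgs vs) A₂))
  | inp {Γ x n σ A₁ hA₁ ys P A₂} : ys.length = n → ys.Nodup → (∀ y ∈ ys, y ∉ P.fv) →
      Typed (Γ.extend ys (List.ofFn σ)) (P.withNames ys) A₂ →
      HasTy Γ (.var x) (.chan n σ A₁ hA₁) →
      Sub (.proj A₂ ys.toFinset) (A₁.atArgs (ys.map Val.var)) →
      Typed Γ (.inp (.var x) n P) (.inp x (.excl A₂ ys.toFinset))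
  | par {Γ P Q A B} : Typed Γ P A → Typed Γ Q B → Typed Γ (.par P Q) (.par A B)
  | rep {Γ P A} : Typed Γ P A → Typed Γ (.rep P) (.rep A)
  | ite {Γ v P Q A} : HasTy Γ v .bool → Typed Γ P A → Typed Γ Q A →
      Typed Γ (.ite (.val v) P Q) A
  | new {Γ x n σ A₁ hA₁ P A} : x ∉ P.fv →
      Typed (Γ.extend [x] [.chan n σ A₁ hA₁]) (P.withNames [x]) A →
      Typed Γ (.nu P) (.nu x A)
  | acc {Γ ξ x P A} : Typed Γ P A → HasTy Γ (.var x) .res →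
      Typed Γ (.acc ξ (.var x) P) (.acc ξ x A)
  | newR {Γ x Φ P A} : x ∉ P.fv →
      Typed (Γ.extend [x] [.res]) (P.withNames [x]) A →
      traces x A ⊆ Φ.carrier →
      Typed Γ (.nuR Φ P) (.excl A {x})
  | sub {Γ P A' A} : Typed Γ P A' → Sub A' A → Typed Γ P A

end ResPi

namespace ResPi

universe u

variable {Λ : Type u}

/-! # Weak transitions and subtyping -/

/-! The core is a subject reduction theorem that also carries safety, `Red.typed`: if `P` has type
`T` and reduces with label `L`, then `T` weakly performs `L` and reaches a type of the reduct. A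
trace set changes only when an access `x^ξ` happens under `(𝔑x:Φ)`, which leaves `Φ^{-ξ}`. The type
`A` of the body then weakly performs `x^ξ`, so the one-letter sequence `ξ` is in `traces x A ⊆ Φ`,
and `Φ^{-ξ}` contains the empty sequence. The traces of the new type, prefixed by `ξ`, are traces of
`A`, so they lie in `Φ^{-ξ}`.

The rest is a calculus of inequalities between behaviors. Subsumption absorbs them, so a law is
often needed in one direction only. Communication rests on the substitution lemma `Typed.ren`
(renaming a process renames its type) and on `A ≤ A↓_S | A↑_S` (`Sub.le_proj_par_excl`). The type of
a receiver's body splits into its part on the parameters, which is bounded by the channel type and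
paid for by the sender, and the remainder, which is the continuation of the receiver's type.

Subsumption also lets a type mention variables that are not free in the process, so a name fresh for
`P` need not be fresh for its type. The remedy is strengthening, `Typed.nu`: if `x` is not free in
`P`, the type `A` of `P` may be replaced by `(νx)A`. Change of bound names and scope extrusion
(`Sub.nu_par_extrude`, `Sub.excl_par_extrude`, `Sub.proj_par_extrude`) depend on it.

Two tools keep the simulations small. Restriction, `↑`, `↓` and renaming act on labels only, so
inequalities between their composites reduce to comparing relations on labels (`Inv.sub`).
Replication is handled through `Sub.rep_le`: `*A` lies below every `D` with `A|D ≤ D`. -/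

/-- `l.Fire m`: a transition labelled `l` is also a transition labelled `m`. -/
inductive Lab.Fire : Lab Λ → Lab Λ → Prop
  | refl (l) : Lab.Fire l l
  | com (x) : Lab.Fire (.com x x) .tau

theorem Tr.fire {A B : Beh Λ} {l m} (h : Tr A l B) (f : l.Fire m) : Tr A m B := by
  cases f with
  | refl => exact h
  | com x => exact Tr.com h

theorem WTr.of_tr {A B : Beh Λ} {l} (h : Tr A l B) : WTr A l B :=
  Or.inr ⟨A, B, .refl, h, .refl⟩

theorem Taus.wtr {A B : Beh Λ} (h : Taus A B) : WTr A .tau B := Or.inl ⟨rfl, h⟩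

theorem WTr.taus {A B : Beh Λ} (h : WTr A .tau B) : Taus A B := by
  rcases h with ⟨-, h⟩ | ⟨A₁, B₁, h₁, h₂, h₃⟩
  · exact h
  · exact h₁.trans (.head h₂ h₃)

theorem WTr.of_taus_left {A B C : Beh Λ} {l} (h : Taus A B) (w : WTr B l C) : WTr A l C := by
  rcases w with ⟨rfl, h'⟩ | ⟨A₁, B₁, h₁, h₂, h₃⟩
  · exact Or.inl ⟨rfl, h.trans h'⟩
  · exact Or.inr ⟨A₁, B₁, h.trans h₁, h₂, h₃⟩

theorem WTr.of_taus_right {A B C : Beh Λ} {l} (w : WTr A l B) (h : Taus B C) : WTr A l C := by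
  rcases w with ⟨rfl, h'⟩ | ⟨A₁, B₁, h₁, h₂, h₃⟩
  · exact Or.inl ⟨rfl, h'.trans h⟩
  · exact Or.inr ⟨A₁, B₁, h₁, h₂, h₃.trans h⟩

theorem WTr.fire {A B : Beh Λ} {l m} (w : WTr A l B) (f : l.Fire m) : WTr A m B := by
  cases f with
  | refl => exact w
  | com x =>
    rcases w with ⟨h, -⟩ | ⟨A₁, B₁, h₁, h₂, h₃⟩
    · cases h
    · exact Or.inr ⟨A₁, B₁, h₁, .com h₂, h₃⟩

theorem WTr.cases_of_ne {A B : Beh Λ} {l} (w : WTr A l B) (hl : l ≠ .tau) :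
    ∃ A₁ B₁, Taus A A₁ ∧ Tr A₁ l B₁ ∧ Taus B₁ B := by
  rcases w with ⟨h, -⟩ | h
  · exact absurd h hl
  · exact h

theorem Taus.map (f : Beh Λ → Beh Λ) (hf : ∀ A B, Tr A .tau B → Tr (f A) .tau (f B))
    {A B : Beh Λ} (h : Taus A B) : Taus (f A) (f B) :=
  by
  induction h with
  | refl => exact .refl
  | tail _ t ih => exact ih.tail (hf _ _ t)

theorem Sub.step {A B : Beh Λ} (h : Sub A B) {l A'} (t : Tr A l A') :
    ∃ B', WTr B l B' ∧ Sub A' B' := by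
  obtain ⟨R, hR, hAB⟩ := h
  obtain ⟨B', w, r⟩ := hR A B hAB l A' t
  exact ⟨B', w, R, hR, r⟩

theorem Sub.taus {A B A' : Beh Λ} (h : Sub A B) (t : Taus A A') : ∃ B', Taus B B' ∧ Sub A' B' := by
  induction t with
  | refl => exact ⟨B, .refl, h⟩
  | tail _ t ih =>
    obtain ⟨B₁, w, h₁⟩ := ih
    obtain ⟨B', w', h'⟩ := h₁.step t
    exact ⟨B', w.trans w'.taus, h'⟩

theorem Sub.wtr {A B A' : Beh Λ} {l} (h : Sub A B) (w : WTr A l A') :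
    ∃ B', WTr B l B' ∧ Sub A' B' := by
  rcases w with ⟨rfl, t⟩ | ⟨A₁, A₂, t₁, t, t₂⟩
  · obtain ⟨B', t', h'⟩ := h.taus t
    exact ⟨B', t'.wtr, h'⟩
  · obtain ⟨B₁, u₁, h₁⟩ := h.taus t₁
    obtain ⟨B₂, w, h₂⟩ := h₁.step t
    obtain ⟨B', u₂, h'⟩ := h₂.taus t₂
    exact ⟨B', (WTr.of_taus_left u₁ w).of_taus_right u₂, h'⟩

theorem Sub.refl (A : Beh Λ) : Sub A A :=
  ⟨Eq, fun _ _ e _ A' t => ⟨A', .of_tr (e ▸ t), rfl⟩, rfl⟩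

theorem Sub.trans {A B C : Beh Λ} (h : Sub A B) (h' : Sub B C) : Sub A C := by
  refine ⟨fun A C => ∃ B, Sub A B ∧ Sub B C, ?_, B, h, h'⟩
  rintro A C ⟨B, h, h'⟩ l A' t
  obtain ⟨B', w, h₁⟩ := h.step t
  obtain ⟨C', w', h₂⟩ := h'.wtr w
  exact ⟨C', w', B', h₁, h₂⟩

/-- Simulation up to subtyping on the right. -/
theorem Sub.of_upto (R : Beh Λ → Beh Λ → Prop)
    (hR : ∀ A B, R A B → ∀ l A', Tr A l A' → ∃ B', WTr B l B' ∧ ∃ C, R A' C ∧ Sub C B')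
    {A B : Beh Λ} (h : R A B) : Sub A B := by
  -- Composing `R` with subtyping gives a genuine simulation, since subtyping also transfers weak
  -- transitions.
  refine ⟨fun A B => ∃ C, R A C ∧ Sub C B, ?_, B, h, .refl B⟩
  rintro A B ⟨C, r, s⟩ l A' t
  obtain ⟨C', w, D, r', s'⟩ := hR A C r l A' t
  obtain ⟨B', w', s''⟩ := s.wtr w
  exact ⟨B', w', D, r', s'.trans s''⟩

theorem Sub.of_step {A B : Beh Λ} (h : ∀ l A', Tr A l A' → ∃ B', WTr B l B' ∧ Sub A' B') :
    Sub A B := by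
  refine ⟨fun C D => Sub C D ∨ (C = A ∧ D = B), ?_, Or.inr ⟨rfl, rfl⟩⟩
  rintro C D (s | ⟨rfl, rfl⟩) l A' t
  · obtain ⟨B', w, s'⟩ := s.step t
    exact ⟨B', w, Or.inl s'⟩
  · obtain ⟨B', w, s'⟩ := h l A' t
    exact ⟨B', w, Or.inl s'⟩

theorem Sub.of_tr {A B : Beh Λ} (h : ∀ l A', Tr A l A' → Tr B l A') : Sub A B :=
  .of_step fun l A' t => ⟨A', .of_tr (h l A' t), .refl A'⟩

/-- Whatever `B` can do, `A` can do after the silent steps that lead to `B`. Hence silent steps can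
only lose traces. -/
theorem Sub.of_taus {A B : Beh Λ} (h : Taus A B) : Sub B A :=
  .of_step fun _ A' t => ⟨A', .of_taus_left h (.of_tr t), .refl A'⟩

theorem HasTrace.mono {x : Var} {A B : Beh Λ} (h : Sub A B) :
    ∀ {s}, HasTrace x A s → HasTrace x B s := by
  intro s
  induction s generalizing A B with
  | nil => intro _; trivial
  | cons ξ s ih =>
    rintro ⟨A', w, t⟩
    obtain ⟨B', w', h'⟩ := h.wtr w
    exact ⟨B', w', ih h' t⟩

/-! # Transitions of prefixes -/

/-- The rule `Tr.com` applies to a source of any shape, so a transition cannot be inverted by its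
last rule alone. This and the later inversions go by induction on the derivation, and the `com` case
calls the induction hypothesis. -/
theorem Tr.nil_inv {l} {X : Beh Λ} (h : Tr .nil l X) : False := by
  generalize e : Beh.nil = C at h
  induction h <;> try cases e
  case com ih => exact ih rfl

theorem Tr.inp_inv {x} {A X : Beh Λ} {l} (h : Tr (.inp x A) l X) : l = .inp (.var x) ∧ X = A := by
  generalize e : Beh.inp x A = C at h
  induction h <;> try cases e
  case inp => exact ⟨rfl, rfl⟩
  case com ih => cases (ih rfl).1

theorem Tr.out_inv {x} {A X : Beh Λ} {l} (h : Tr (.out x A) l X) : l = .out (.var x) ∧ X = A := by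
  generalize e : Beh.out x A = C at h
  induction h <;> try cases e
  case out => exact ⟨rfl, rfl⟩
  case com ih => cases (ih rfl).1

theorem Tr.acc_inv {x ξ} {A X : Beh Λ} {l} (h : Tr (.acc ξ x A) l X) :
    l = .acc (.var x) ξ ∧ X = A := by
  generalize e : Beh.acc ξ x A = C at h
  induction h <;> try cases e
  case acc => exact ⟨rfl, rfl⟩
  case com ih => cases (ih rfl).1

theorem Sub.nil (A : Beh Λ) : Sub .nil A := .of_step fun _ _ t => t.nil_inv.elim

theorem Sub.inp (x) {A B : Beh Λ} (h : Sub A B) : Sub (.inp x A) (.inp x B) := by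
  refine .of_step fun l A' t => ?_
  obtain ⟨rfl, rfl⟩ := t.inp_inv
  exact ⟨B, .of_tr (.inp x B), h⟩

theorem Sub.out (x) {A B : Beh Λ} (h : Sub A B) : Sub (.out x A) (.out x B) := by
  refine .of_step fun l A' t => ?_
  obtain ⟨rfl, rfl⟩ := t.out_inv
  exact ⟨B, .of_tr (.out x B), h⟩

/-! # Parallel composition -/

theorem Tr.par_inv {A B X : Beh Λ} {l} (h : Tr (.par A B) l X) :
    (∃ A', Tr A l A' ∧ X = .par A' B) ∨ (∃ B', Tr B l B' ∧ X = .par A B') ∨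
    (∃ A' B' x y, Tr A (.inp x) A' ∧ Tr B (.out y) B' ∧ (Lab.com x y).Fire l ∧ X = .par A' B') ∨
    (∃ A' B' x y, Tr A (.out y) A' ∧ Tr B (.inp x) B' ∧ (Lab.com x y).Fire l ∧
      X = .par A' B') := by
  generalize e : Beh.par A B = C at h
  induction h <;> try cases e
  case parL h _ => exact Or.inl ⟨_, h, rfl⟩
  case parR h _ => exact Or.inr (Or.inl ⟨_, h, rfl⟩)
  case par2L h _ h' _ => exact Or.inr (Or.inr (Or.inl ⟨_, _, _, _, h, h', .refl _, rfl⟩))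
  case par2R h _ h' _ => exact Or.inr (Or.inr (Or.inr ⟨_, _, _, _, h, h', .refl _, rfl⟩))
  case com ih =>
    rcases ih rfl with ⟨A', t, rfl⟩ | ⟨B', t, rfl⟩ | ⟨A', B', x, y, t, t', f, rfl⟩ |
      ⟨A', B', x, y, t, t', f, rfl⟩
    · exact Or.inl ⟨_, .com t, rfl⟩
    · exact Or.inr (Or.inl ⟨_, .com t, rfl⟩)
    · cases f
      exact Or.inr (Or.inr (Or.inl ⟨_, _, _, _, t, t', .com _, rfl⟩))
    · cases f
      exact Or.inr (Or.inr (Or.inr ⟨_, _, _, _, t, t', .com _, rfl⟩))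

theorem Taus.parL {A A' : Beh Λ} (B) (h : Taus A A') : Taus (.par A B) (.par A' B) :=
  h.map (fun A => .par A B) fun _ _ => .parL B

theorem Taus.parR {B B' : Beh Λ} (A) (h : Taus B B') : Taus (.par A B) (.par A B') :=
  h.map (fun B => .par A B) fun _ _ => .parR A

theorem WTr.parL {A A' : Beh Λ} {l} (B) (h : WTr A l A') : WTr (.par A B) l (.par A' B) := by
  rcases h with ⟨rfl, t⟩ | ⟨A₁, A₂, t₁, t, t₂⟩
  · exact (t.parL B).wtr
  · exact Or.inr ⟨_, _, t₁.parL B, .parL B t, t₂.parL B⟩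

theorem WTr.parR {B B' : Beh Λ} {l} (A) (h : WTr B l B') : WTr (.par A B) l (.par A B') := by
  rcases h with ⟨rfl, t⟩ | ⟨A₁, A₂, t₁, t, t₂⟩
  · exact (t.parR A).wtr
  · exact Or.inr ⟨_, _, t₁.parR A, .parR A t, t₂.parR A⟩

theorem WTr.par2L {A A' B B' : Beh Λ} {x y} (h : WTr A (.inp x) A') (h' : WTr B (.out y) B') :
    WTr (.par A B) (.com x y) (.par A' B') := by
  obtain ⟨A₁, A₂, t₁, t, t₂⟩ := h.cases_of_ne (by simp)
  obtain ⟨B₁, B₂, u₁, u, u₂⟩ := h'.cases_of_ne (by simp)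
  exact Or.inr ⟨_, _, (t₁.parL B).trans (u₁.parR A₁), .par2L t u, (t₂.parL B₂).trans (u₂.parR A')⟩

theorem WTr.par2R {A A' B B' : Beh Λ} {x y} (h : WTr A (.out y) A') (h' : WTr B (.inp x) B') :
    WTr (.par A B) (.com x y) (.par A' B') := by
  obtain ⟨A₁, A₂, t₁, t, t₂⟩ := h.cases_of_ne (by simp)
  obtain ⟨B₁, B₂, u₁, u, u₂⟩ := h'.cases_of_ne (by simp)
  exact Or.inr ⟨_, _, (t₁.parL B).trans (u₁.parR A₁), .par2R t u, (t₂.parL B₂).trans (u₂.parR A')⟩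

theorem Sub.par {A A' B B' : Beh Λ} (h : Sub A A') (h' : Sub B B') :
    Sub (.par A B) (.par A' B') := by
  refine ⟨fun X Y => ∃ A A' B B', Sub A A' ∧ Sub B B' ∧ X = .par A B ∧ Y = .par A' B', ?_,
    A, A', B, B', h, h', rfl, rfl⟩
  rintro _ _ ⟨A, C, B, D, h, h', rfl, rfl⟩ l X t₀
  rcases t₀.par_inv with ⟨A', t, rfl⟩ | ⟨B', t, rfl⟩ | ⟨A', B', x, y, t, t', f, rfl⟩ |
      ⟨A', B', x, y, t, t', f, rfl⟩
  · obtain ⟨C', w, s⟩ := h.step t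
    exact ⟨_, w.parL D, _, _, _, _, s, h', rfl, rfl⟩
  · obtain ⟨D', w, s⟩ := h'.step t
    exact ⟨_, w.parR C, _, _, _, _, h, s, rfl, rfl⟩
  · obtain ⟨C', w, s⟩ := h.step t
    obtain ⟨D', w', s'⟩ := h'.step t'
    exact ⟨_, (w.par2L w').fire f, _, _, _, _, s, s', rfl, rfl⟩
  · obtain ⟨C', w, s⟩ := h.step t
    obtain ⟨D', w', s'⟩ := h'.step t'
    exact ⟨_, (w.par2R w').fire f, _, _, _, _, s, s', rfl, rfl⟩

theorem Sub.par_comm (A B : Beh Λ) : Sub (.par A B) (.par B A) := by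
  refine ⟨fun X Y => ∃ A B, X = .par A B ∧ Y = .par B A, ?_, A, B, rfl, rfl⟩
  rintro _ _ ⟨A, B, rfl, rfl⟩ l X t₀
  rcases t₀.par_inv with ⟨A', t, rfl⟩ | ⟨B', t, rfl⟩ | ⟨A', B', x, y, t, t', f, rfl⟩ |
      ⟨A', B', x, y, t, t', f, rfl⟩
  · exact ⟨_, .of_tr (t.parR B), _, _, rfl, rfl⟩
  · exact ⟨_, .of_tr (t.parL A), _, _, rfl, rfl⟩
  · exact ⟨_, .of_tr ((t'.par2R t).fire f), _, _, rfl, rfl⟩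
  · exact ⟨_, .of_tr ((t'.par2L t).fire f), _, _, rfl, rfl⟩

theorem Sub.par_assoc (A B C : Beh Λ) : Sub (.par A (.par B C)) (.par (.par A B) C) := by
  refine ⟨fun X Y => ∃ A B C, X = .par A (.par B C) ∧ Y = .par (.par A B) C, ?_,
    A, B, C, rfl, rfl⟩
  rintro _ _ ⟨A, B, C, rfl, rfl⟩ l X t₀
  rcases t₀.par_inv with ⟨A', t, rfl⟩ | ⟨B', t₁, rfl⟩ | ⟨A', B', x, y, t, t₁, f, rfl⟩ |
      ⟨A', B', x, y, t, t₁, f, rfl⟩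
  · exact ⟨_, .of_tr ((t.parL B).parL C), _, _, _, rfl, rfl⟩
  · rcases t₁.par_inv with ⟨A', t, rfl⟩ | ⟨B', t, rfl⟩ | ⟨A', B', x, y, t, t', f, rfl⟩ |
      ⟨A', B', x, y, t, t', f, rfl⟩
    · exact ⟨_, .of_tr ((t.parR A).parL C), _, _, _, rfl, rfl⟩
    · exact ⟨_, .of_tr (t.parR _), _, _, _, rfl, rfl⟩
    · exact ⟨_, .of_tr (((t.parR A).par2L t').fire f), _, _, _, rfl, rfl⟩
    · exact ⟨_, .of_tr (((t.parR A).par2R t').fire f), _, _, _, rfl, rfl⟩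
  · rcases t₁.par_inv with ⟨A', t', rfl⟩ | ⟨B', t', rfl⟩ | ⟨_, _, _, _, _, _, f', _⟩ |
      ⟨_, _, _, _, _, _, f', _⟩
    · exact ⟨_, .of_tr (((t.par2L t').parL C).fire f), _, _, _, rfl, rfl⟩
    · exact ⟨_, .of_tr (((t.parL B).par2L t').fire f), _, _, _, rfl, rfl⟩
    -- A synchronization inside `B|C` is labelled `{x, ȳ}` or `τ`, never by a lone input or output,
    -- so it cannot take part in another one.
    · cases f'
    · cases f'
  · rcases t₁.par_inv with ⟨A', t', rfl⟩ | ⟨B', t', rfl⟩ | ⟨_, _, _, _, _, _, f', _⟩ |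
      ⟨_, _, _, _, _, _, f', _⟩
    · exact ⟨_, .of_tr (((t.par2R t').parL C).fire f), _, _, _, rfl, rfl⟩
    · exact ⟨_, .of_tr (((t.parL B).par2R t').fire f), _, _, _, rfl, rfl⟩
    · cases f'
    · cases f'

theorem Sub.par_assoc' (A B C : Beh Λ) : Sub (.par (.par A B) C) (.par A (.par B C)) :=
  (par_comm _ _).trans <| (par_assoc C A B).trans <| (par_comm _ _).trans <|
    (par_assoc B C A).trans (par_comm _ _)

theorem Sub.le_par (A B : Beh Λ) : Sub A (.par A B) := by
  refine ⟨fun X Y => Y = .par X B, ?_, rfl⟩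
  rintro X _ rfl l X' t
  exact ⟨_, .of_tr (t.parL B), rfl⟩

theorem Sub.par_nil (A : Beh Λ) : Sub (.par A .nil) A := by
  refine ⟨fun Y X => Y = .par X .nil, ?_, rfl⟩
  rintro _ X rfl l X' t₀
  rcases t₀.par_inv with ⟨A', t, rfl⟩ | ⟨B', t, rfl⟩ | ⟨A', B', x, y, t, t', f, rfl⟩ |
      ⟨A', B', x, y, t, t', f, rfl⟩
  · exact ⟨_, .of_tr t, rfl⟩
  · exact t.nil_inv.elim
  · exact t'.nil_inv.elim
  · exact t'.nil_inv.elim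

/-! # Replication -/

theorem Sub.par_rep (A : Beh Λ) : Sub (.par A (.rep A)) (.rep A) := .of_tr fun _ _ => .rep

/-- The candidate simulation for `Sub.rep_le`. -/
inductive RepRel (A D : Beh Λ) : Beh Λ → Beh Λ → Prop
  | sub {X Y} : Sub X Y → RepRel A D X Y
  | rep {Y} : Sub D Y → RepRel A D (.rep A) Y
  | par {X Y X' Y' Z} : RepRel A D X Y → RepRel A D X' Y' → Sub (.par Y Y') Z →
      RepRel A D (.par X X') Z

/-- Unfolding `*A` into `A|*A` enlarges the term, so the induction is on the derivation of the
transition, for all `Y`. In the `rep` case the unfolded pair is still related to the same `Y`,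
because `A|D ≤ D`. A source that is neither a composition nor a replication is related by subtyping
alone. -/
theorem RepRel.step {A D : Beh Λ} (h : Sub (.par A D) D) {X l X'} (t : Tr X l X') :
    ∀ {Y}, RepRel A D X Y → ∃ Y', WTr Y l Y' ∧ ∃ Z, RepRel A D X' Z ∧ Sub Z Y' := by
  have tail {X Y Z W l} (s : Sub Y Z) (w : WTr Y l W) (r : RepRel A D X W) :
      ∃ Y', WTr Z l Y' ∧ ∃ Z, RepRel A D X Z ∧ Sub Z Y' := by
    obtain ⟨Y', w', s'⟩ := s.wtr w
    exact ⟨Y', w', W, r, s'⟩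
  have base {X l X' Y} (t : Tr X l X') (s : Sub X Y) :
      ∃ Y', WTr Y l Y' ∧ ∃ Z, RepRel A D X' Z ∧ Sub Z Y' := by
    obtain ⟨Y', w, s'⟩ := s.step t
    exact ⟨Y', w, X', .sub (.refl _), s'⟩
  induction t with
  | com t ih =>
    intro Y r
    obtain ⟨Y', w, r'⟩ := ih r
    exact ⟨Y', w.fire (.com _), r'⟩
  | rep t ih =>
    intro Y r
    cases r with
    | sub s => exact base (.rep t) s
    | rep s => exact ih (.par (.sub (.refl A)) (.rep (.refl D)) (h.trans s))
  | parL B t ih =>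
    intro Y r
    cases r with
    | sub s => exact base (.parL B t) s
    | par r r' s =>
      obtain ⟨Y', w, Z, q, p⟩ := ih r
      exact tail s (w.parL _) (.par q r' (p.par (.refl _)))
  | parR B t ih =>
    intro Y r
    cases r with
    | sub s => exact base (.parR B t) s
    | par r r' s =>
      obtain ⟨Y', w, Z, q, p⟩ := ih r'
      exact tail s (w.parR _) (.par r q (Sub.par (.refl _) p))
  | par2L t t' ih₁ ih₂ =>
    intro Y r
    cases r with
    | sub s => exact base (.par2L t t') s
    | par r r' s =>
      obtain ⟨Y', w, Z, q, p⟩ := ih₁ r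
      obtain ⟨Y'', w', Z', q', p'⟩ := ih₂ r'
      exact tail s (w.par2L w') (.par q q' (p.par p'))
  | par2R t t' ih₁ ih₂ =>
    intro Y r
    cases r with
    | sub s => exact base (.par2R t t') s
    | par r r' s =>
      obtain ⟨Y', w, Z, q, p⟩ := ih₁ r
      obtain ⟨Y'', w', Z', q', p'⟩ := ih₂ r'
      exact tail s (w.par2R w') (.par q q' (p.par p'))
  | inp x A => intro Y r; cases r with | sub s => exact base (.inp x A) s
  | out x A => intro Y r; cases r with | sub s => exact base (.out x A) s
  | acc ξ x A => intro Y r; cases r with | sub s => exact base (.acc ξ x A) s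
  | tau A => intro Y r; cases r with | sub s => exact base (.tau A) s
  | choiceL B t => intro Y r; cases r with | sub s => exact base (.choiceL B t) s
  | choiceR B t => intro Y r; cases r with | sub s => exact base (.choiceR B t) s
  | mu e t => intro Y r; cases r with | sub s => exact base (.mu e t) s
  | ren θ t => intro Y r; cases r with | sub s => exact base (.ren θ t) s
  | nu x t d => intro Y r; cases r with | sub s => exact base (.nu x t d) s
  | exclOut S t d => intro Y r; cases r with | sub s => exact base (.exclOut S t d) s
  | exclIn S t d => intro Y r; cases r with | sub s => exact base (.exclIn S t d) s
  | projOut S t d => intro Y r; cases r with | sub s => exact base (.projOut S t d) s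
  | projIn S t d => intro Y r; cases r with | sub s => exact base (.projIn S t d) s

/-- `*A` is below every behavior that absorbs `A`. -/
theorem Sub.rep_le {A D : Beh Λ} (h : Sub (.par A D) D) : Sub (.rep A) D :=
  .of_upto (RepRel A D) (fun _ _ r _ _ t => RepRel.step h t r) (.rep (.refl D))

/-! # Free variables and transitions -/

theorem Ren.mem_dom {θ : Ren} {x : Var} : x ∈ Ren.dom θ ↔ ∃ v, (x, v) ∈ θ := by
  simp [Ren.dom]

theorem Ren.mem_rangeVars {θ : Ren} {z : Var} :
    z ∈ Ren.rangeVars θ ↔ ∃ p ∈ θ, z ∈ p.2.fv := by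
  induction θ with
  | nil => simp [Ren.rangeVars]
  | cons p θ ih => simp_all [Ren.rangeVars]

theorem Ren.mem_of_lookup {θ : Ren} {x : Var} {v : Val} (h : θ.lookup x = some v) :
    (x, v) ∈ θ := by
  induction θ with
  | nil => simp at h
  | cons p θ ih =>
    obtain ⟨y, w⟩ := p
    rw [List.lookup_cons] at h
    by_cases e : x = y
    · subst e; simp at h; simp [h]
    · rw [beq_false_of_ne e] at h; exact List.mem_cons_of_mem _ (ih h)

theorem Val.ren_of_lookup {θ : Ren} {x : Var} {v : Val} (h : θ.lookup x = some v) :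
    (Val.var x).ren θ = v := by
  simp [Val.ren, h]

theorem Val.ren_of_lookup_none {θ : Ren} {x : Var} (h : θ.lookup x = none) :
    (Val.var x).ren θ = .var x := by
  simp [Val.ren, h]

theorem Val.mem_of_ren_eq {θ : Ren} {v : Val} {z : Var} {S : Finset Var}
    (h : v.ren θ = .var z) (hv : ∀ x, v = .var x → x ∈ S) :
    z ∈ (S \ Ren.dom θ) ∪ Ren.rangeVars θ := by
  cases v with
  | bool b => simp [Val.ren] at h
  | var x =>
    cases e : θ.lookup x with
    | none =>
      rw [Val.ren_of_lookup_none e] at h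
      cases h
      by_cases hz : z ∈ Ren.dom θ
      · obtain ⟨v, hv⟩ := Ren.mem_dom.1 hz
        exact absurd e (by
          simp only [List.lookup_eq_none_iff, not_forall]
          exact ⟨_, hv, by simp⟩)
      · simp [hv z rfl, hz]
    | some w =>
      rw [Val.ren_of_lookup e] at h
      subst h
      refine Finset.mem_union_right _ (Ren.mem_rangeVars.2 ⟨_, Ren.mem_of_lookup e, ?_⟩)
      simp [Val.fv]

theorem Val.fv_perm (π : Equiv.Perm Var) (v : Val) : (v.perm π).fv = v.fv.image π := by
  cases v <;> simp [Val.perm, Val.fv]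

theorem Beh.fv_perm (π : Equiv.Perm Var) (A : Beh Λ) : (A.perm π).fv = A.fv.image π := by
  induction A with
  | ren θ A ih =>
    have hd : Ren.dom (θ.map fun p => (π p.1, p.2.perm π)) = (Ren.dom θ).image π := by
      ext z; simp [Ren.dom]
    have hr : Ren.rangeVars (θ.map fun p => (π p.1, p.2.perm π)) = (Ren.rangeVars θ).image π := by
      ext z
      simp only [Ren.mem_rangeVars, Finset.mem_image, List.mem_map]
      constructor
      · rintro ⟨_, ⟨p, hp, rfl⟩, hz⟩
        rw [Val.fv_perm] at hz
        obtain ⟨w, hw, rfl⟩ := Finset.mem_image.1 hz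
        exact ⟨w, ⟨p, hp, hw⟩, rfl⟩
      · rintro ⟨w, ⟨p, hp, hw⟩, rfl⟩
        exact ⟨_, ⟨p, hp, rfl⟩, by rw [Val.fv_perm]; exact Finset.mem_image_of_mem _ hw⟩
    simp only [perm, fv, ih, hd, hr]
    rw [Finset.image_union, Finset.image_sdiff _ _ π.injective]
  | nu x A ih =>
    simp only [perm, fv, ih]
    rw [Finset.image_sdiff _ _ π.injective, Finset.image_singleton]
  | excl A S ih =>
    simp only [perm, fv, ih]
    rw [Finset.image_sdiff _ _ π.injective, Finset.map_eq_image]; rfl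
  | proj A S ih =>
    simp only [perm, fv, ih]
    rw [Finset.image_inter _ _ π.injective, Finset.map_eq_image]; rfl
  | _ => simp_all [perm, fv, Finset.image_union]

theorem Beh.fv_subset_vars (A : Beh Λ) : A.fv ⊆ A.vars := by
  induction A <;> (simp only [fv, vars]; grind)

theorem Beh.fv_lift (A : Beh Λ) : ∀ c, (A.lift c).fv = A.fv := by
  induction A <;> intro c <;> simp_all [lift, fv]
  split <;> rfl

/-- In the `ν` case the swap of `x` and `z` disturbs no other free variable: `z` is `x` itself or
does not occur in the body at all. -/
theorem TSubst.fv_subset {C A B : Beh Λ} {k} (h : TSubst C k A B) : B.fv ⊆ A.fv ∪ C.fv := by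
  induction h with
  | @nu C k A B x z hz hxz _ ih =>
    intro w hw
    simp only [Beh.fv, Finset.mem_sdiff, Finset.mem_singleton, Finset.mem_union] at hw ⊢
    rcases Finset.mem_union.1 (ih hw.1) with h | h
    · rw [Beh.fv_perm, Finset.mem_image] at h
      obtain ⟨y, hy, rfl⟩ := h
      left
      by_cases h₁ : y = x
      · subst h₁; simp at hw
      · by_cases h₂ : y = z
        · subst h₂
          rcases hxz with rfl | hxz
          · exact absurd rfl h₁
          · exact absurd (Beh.fv_subset_vars A hy) hxz
        · rw [Equiv.swap_apply_of_ne_of_ne h₁ h₂]; exact ⟨hy, h₁⟩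
    · exact Or.inr h
  | mu _ ih => simpa [Beh.fv, Beh.fv_lift] using ih
  | _ => simp only [Beh.fv] at *; grind

/-- All variables of the label are in `S`. -/
def Lab.Over (l : Lab Λ) (S : Finset Var) : Prop := ∀ x, Val.var x ∈ l.target → x ∈ S

theorem Lab.target_ren (θ : Ren) (l : Lab Λ) : (l.ren θ).target = Val.ren θ '' l.target := by
  cases l <;> simp [ren, target, Set.image_pair]

theorem Lab.Over.mono {l : Lab Λ} {S T : Finset Var} (h : l.Over S) (hST : S ⊆ T) : l.Over T :=
  fun x hx => hST (h x hx)

/-- This is what allows operators to be compared only on labels over the free variables of the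
initial behavior: the bound persists along transitions. -/
theorem Tr.fv {A A' : Beh Λ} {l} (h : Tr A l A') : l.Over A.fv ∧ A'.fv ⊆ A.fv := by
  induction h with
  | @ren A l A' θ t ih =>
    constructor
    · intro z hz
      rw [Lab.target_ren] at hz
      obtain ⟨v, hv, e⟩ := hz
      exact Val.mem_of_ren_eq e fun x hx => ih.1 x (hx ▸ hv)
    · simp only [Beh.fv]
      exact Finset.union_subset_union_left (Finset.sdiff_subset_sdiff ih.2 (Finset.Subset.refl _))
  | mu s t ih =>
    have := s.fv_subset
    simp only [Beh.fv, Finset.union_idempotent] at this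
    exact ⟨ih.1.mono this, ih.2.trans this⟩
  | nu x t d ih =>
    refine ⟨fun z hz => ?_, ?_⟩
    · simp only [Beh.fv, Finset.mem_sdiff]
      exact ⟨ih.1 z hz, fun h => Set.disjoint_left.1 d hz ⟨z, h, rfl⟩⟩
    · simp only [Beh.fv]; exact Finset.sdiff_subset_sdiff ih.2 (Finset.Subset.refl _)
  | exclOut S t d ih =>
    refine ⟨fun z hz => ?_, ?_⟩
    · simp only [Beh.fv, Finset.mem_sdiff]
      exact ⟨ih.1 z hz, fun h => Set.disjoint_left.1 d hz ⟨z, h, rfl⟩⟩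
    · simp only [Beh.fv]; exact Finset.sdiff_subset_sdiff ih.2 (Finset.Subset.refl _)
  | exclIn S t d ih =>
    refine ⟨fun z hz => hz.elim, ?_⟩
    simp only [Beh.fv]; exact Finset.sdiff_subset_sdiff ih.2 (Finset.Subset.refl _)
  | projOut S t d ih =>
    refine ⟨fun z hz => hz.elim, ?_⟩
    simp only [Beh.fv]; exact Finset.inter_subset_inter_right ih.2
  | projIn S t d ih =>
    refine ⟨fun z hz => ?_, ?_⟩
    · simp only [Beh.fv, Finset.mem_inter]
      obtain ⟨y, hy, e⟩ := d hz
      cases e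
      exact ⟨ih.1 _ hz, hy⟩
    · simp only [Beh.fv]; exact Finset.inter_subset_inter_right ih.2
  | _ => simp only [Lab.Over, Lab.target, Beh.fv, Set.mem_singleton_iff, Set.mem_insert_iff,
      Val.var.injEq, Set.mem_empty_iff_false] at *; grind

/-! # Operators that act on labels -/

/-- The transitions of `C A` are those of `A`, with labels changed according to `F`. -/
def Inv (C : Beh Λ → Beh Λ) (F : Lab Λ → Lab Λ → Prop) : Prop :=
  ∀ ⦃A l X⦄, Tr (C A) l X → ∃ l' A', Tr A l' A' ∧ F l' l ∧ X = C A'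

/-- The operator `C` lifts transitions, with labels changed according to `F`. -/
def Fwd (C : Beh Λ → Beh Λ) (F : Lab Λ → Lab Λ → Prop) : Prop :=
  ∀ ⦃A l A' m⦄, Tr A l A' → F l m → Tr (C A) m (C A')

theorem Inv.id : Inv (fun A : Beh Λ => A) Eq := fun _ l X t => ⟨l, X, t, rfl, rfl⟩

theorem Fwd.id : Fwd (fun A : Beh Λ => A) Eq := fun _ _ _ _ t e => e ▸ t

theorem Inv.comp {C D : Beh Λ → Beh Λ} {F G} (hC : Inv C F) (hD : Inv D G) :
    Inv (fun A => C (D A)) (fun l m => ∃ k, G l k ∧ F k m) := by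
  intro A l X t
  obtain ⟨k, Y, t₁, f, rfl⟩ := hC t
  obtain ⟨l', Z, t₂, g, rfl⟩ := hD t₁
  exact ⟨l', Z, t₂, ⟨k, g, f⟩, rfl⟩

theorem Fwd.comp {C D : Beh Λ → Beh Λ} {F G} (hC : Fwd C F) (hD : Fwd D G) :
    Fwd (fun A => C (D A)) (fun l m => ∃ k, G l k ∧ F k m) := by
  rintro A l A' m t ⟨k, g, f⟩
  exact hC (hD t g) f

/-- Both operators sit on the same behavior, which evolves in the same way on both sides; only
labels have to be compared. `Fire` is allowed because a `{x, x̄}` of the inner behavior may be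
answered as a `τ`. -/
theorem Inv.sub {C D : Beh Λ → Beh Λ} {F G} (hC : Inv C F) (hD : Fwd D G) (A : Beh Λ)
    (h : ∀ l m, l.Over A.fv → F l m → ∃ k, l.Fire k ∧ G k m) : Sub (C A) (D A) := by
  refine ⟨fun X Y => ∃ B : Beh Λ, B.fv ⊆ A.fv ∧ X = C B ∧ Y = D B, ?_,
    A, Finset.Subset.refl _, rfl, rfl⟩
  rintro _ _ ⟨B, hB, rfl, rfl⟩ l X t
  obtain ⟨l', B', t₁, f, rfl⟩ := hC t
  obtain ⟨k, fk, g⟩ := h l' l (t₁.fv.1.mono hB) f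
  exact ⟨_, .of_tr (hD (t₁.fire fk) g), B', t₁.fv.2.trans hB, rfl, rfl⟩

theorem Fwd.taus {C : Beh Λ → Beh Λ} {F} (hC : Fwd C F) (hF : F .tau .tau) {A B : Beh Λ}
    (h : Taus A B) : Taus (C A) (C B) :=
  h.map C fun _ _ t => hC t hF

theorem Fwd.wtr {C : Beh Λ → Beh Λ} {F} (hC : Fwd C F) (hF : F .tau .tau)
    (hF' : ∀ m, F .tau m → m = .tau) {A B : Beh Λ} {l m} (h : WTr A l B) (f : F l m) :
    WTr (C A) m (C B) := by
  rcases h with ⟨rfl, t⟩ | ⟨A₁, A₂, t₁, t, t₂⟩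
  · obtain rfl := hF' m f
    exact (hC.taus hF t).wtr
  · exact Or.inr ⟨_, _, hC.taus hF t₁, hC t f, hC.taus hF t₂⟩

/-- A weak `τ` may consist of no step at all, so it can answer only a `τ`. For this reason the image
of `τ` must be `τ` alone. -/
theorem Inv.congr {C : Beh Λ → Beh Λ} {F} (hC : Inv C F) (hC' : Fwd C F) (hF : F .tau .tau)
    (hF' : ∀ m, F .tau m → m = .tau) {A B : Beh Λ} (h : Sub A B) : Sub (C A) (C B) := by
  refine ⟨fun X Y => ∃ A B, Sub A B ∧ X = C A ∧ Y = C B, ?_, A, B, h, rfl, rfl⟩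
  rintro _ _ ⟨A, B, h, rfl, rfl⟩ l X t
  obtain ⟨l', A', t₁, f, rfl⟩ := hC t
  obtain ⟨B', w, h'⟩ := h.step t₁
  exact ⟨_, hC'.wtr hF hF' w f, _, _, h', rfl, rfl⟩

/-! ### The effect of restriction, exclusion, projection and renaming on labels -/

def nuLab (x : Var) (l m : Lab Λ) : Prop := m = l ∧ Disjoint l.target (varSet {x})

def exclLab (S : Finset Var) (l m : Lab Λ) : Prop :=
  (m = l ∧ Disjoint l.target (varSet S)) ∨ (m = .tau ∧ l.target ⊆ varSet S)

def projLab (S : Finset Var) (l m : Lab Λ) : Prop :=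
  (m = .tau ∧ Disjoint l.target (varSet S)) ∨ (m = l ∧ l.target ⊆ varSet S)

/-- Renaming can identify the ends of `{x, ȳ}`; the result is then also a silent transition, hence
the `Fire`. -/
def renLab (θ : Ren) (l m : Lab Λ) : Prop := (l.ren θ).Fire m

theorem mem_varSet {x : Var} {S : Finset Var} : Val.var x ∈ varSet S ↔ x ∈ S := by
  simp [varSet]

theorem bool_not_mem_varSet {b : Bool} {S : Finset Var} : Val.bool b ∉ varSet S := by
  simp [varSet]

theorem nuLab_tau (x) : nuLab x (.tau : Lab Λ) .tau := ⟨rfl, by simp [Lab.target]⟩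

theorem exclLab_tau (S) : exclLab S (.tau : Lab Λ) .tau := Or.inl ⟨rfl, by simp [Lab.target]⟩

theorem projLab_tau (S) : projLab S (.tau : Lab Λ) .tau := Or.inl ⟨rfl, by simp [Lab.target]⟩

theorem renLab_tau (θ) : renLab θ (.tau : Lab Λ) .tau := .refl _

theorem eq_tau_of_renLab {θ} {m : Lab Λ} (h : renLab θ .tau m) : m = .tau := by
  cases h; rfl

theorem eq_com_of_renLab {θ} {l : Lab Λ} {v w} (h : renLab θ l (.com v w)) :
    l.ren θ = .com v w := by
  unfold renLab at h
  generalize l.ren θ = j at h ⊢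
  cases h
  rfl

theorem inv_nu (x) : Inv (Beh.nu x : Beh Λ → Beh Λ) (nuLab x) := by
  intro A l X t
  generalize e : Beh.nu x A = C at t
  induction t <;> try cases e
  case nu d t _ => exact ⟨_, _, t, ⟨rfl, d⟩, rfl⟩
  case com ih =>
    obtain ⟨l, A', t, ⟨rfl, -⟩, rfl⟩ := ih rfl
    exact ⟨_, _, t.com, nuLab_tau x, rfl⟩

theorem fwd_nu (x) : Fwd (Beh.nu x : Beh Λ → Beh Λ) (nuLab x) := by
  rintro A l A' m t ⟨rfl, d⟩
  exact t.nu x d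

theorem inv_excl (S) : Inv (fun A : Beh Λ => A.excl S) (exclLab S) := by
  intro A l X t
  change Tr (A.excl S) l X at t
  generalize e : A.excl S = C at t
  induction t <;> try cases e
  case exclOut t _ d => exact ⟨_, _, t, Or.inl ⟨rfl, d⟩, rfl⟩
  case exclIn t _ d => exact ⟨_, _, t, Or.inr ⟨rfl, d⟩, rfl⟩
  case com ih =>
    obtain ⟨l, A', t, ⟨rfl, -⟩ | ⟨h, -⟩, rfl⟩ := ih rfl
    · exact ⟨_, _, t.com, exclLab_tau S, rfl⟩
    · cases h

theorem fwd_excl (S) : Fwd (fun A : Beh Λ => A.excl S) (exclLab S) := by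
  rintro A l A' m t (⟨rfl, d⟩ | ⟨rfl, d⟩)
  · exact t.exclOut S d
  · exact t.exclIn S d

theorem inv_proj (S) : Inv (fun A : Beh Λ => A.proj S) (projLab S) := by
  intro A l X t
  change Tr (A.proj S) l X at t
  generalize e : A.proj S = C at t
  induction t <;> try cases e
  case projOut t _ d => exact ⟨_, _, t, Or.inl ⟨rfl, d⟩, rfl⟩
  case projIn t _ d => exact ⟨_, _, t, Or.inr ⟨rfl, d⟩, rfl⟩
  case com ih =>
    obtain ⟨l, A', t, ⟨h, -⟩ | ⟨rfl, -⟩, rfl⟩ := ih rfl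
    · cases h
    · exact ⟨_, _, t.com, projLab_tau S, rfl⟩

theorem fwd_proj (S) : Fwd (fun A : Beh Λ => A.proj S) (projLab S) := by
  rintro A l A' m t (⟨rfl, d⟩ | ⟨rfl, d⟩)
  · exact t.projOut S d
  · exact t.projIn S d

theorem inv_ren (θ) : Inv (Beh.ren θ : Beh Λ → Beh Λ) (renLab θ) := by
  intro A l X t
  generalize e : A.ren θ = C at t
  induction t <;> try cases e
  case ren t _ => exact ⟨_, _, t, .refl _, rfl⟩
  case com ih =>
    obtain ⟨l, A', t, f, rfl⟩ := ih rfl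
    exact ⟨_, _, t, by rw [renLab, eq_com_of_renLab f]; exact .com _, rfl⟩

theorem fwd_ren (θ) : Fwd (Beh.ren θ : Beh Λ → Beh Λ) (renLab θ) :=
  fun _ _ _ _ t f => (t.ren θ).fire f

theorem Sub.nu (x) {A B : Beh Λ} (h : Sub A B) : Sub (.nu x A) (.nu x B) :=
  (inv_nu x).congr (fwd_nu x) (nuLab_tau x) (fun _ h => h.1) h

theorem Sub.excl (S) {A B : Beh Λ} (h : Sub A B) : Sub (.excl A S) (.excl B S) :=
  (inv_excl S).congr (fwd_excl S) (exclLab_tau S) (fun _ h => h.elim And.left And.left) h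

theorem Sub.proj (S) {A B : Beh Λ} (h : Sub A B) : Sub (.proj A S) (.proj B S) :=
  (inv_proj S).congr (fwd_proj S) (projLab_tau S) (fun _ h => h.elim And.left And.left) h

theorem Sub.ren (θ) {A B : Beh Λ} (h : Sub A B) : Sub (.ren θ A) (.ren θ B) :=
  (inv_ren θ).congr (fwd_ren θ) (renLab_tau θ) (fun _ h => eq_tau_of_renLab h) h

/-! # Laws of renaming -/

theorem Lab.ren_congr {θ θ' : Ren} {l : Lab Λ} (h : ∀ x, .var x ∈ l.target →
    (Val.var x).ren θ = (Val.var x).ren θ') : l.ren θ = l.ren θ' := by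
  have h' : ∀ v ∈ l.target, v.ren θ = v.ren θ' := by
    rintro (x | b) hv
    · exact h x hv
    · rfl
  cases l <;> simp [ren, target] at h' ⊢ <;> simp [h']

theorem Val.ren_nil (v : Val) : v.ren [] = v := by cases v <;> simp [Val.ren]

theorem Lab.ren_nil (l : Lab Λ) : l.ren [] = l := by cases l <;> simp [ren, Val.ren_nil]

theorem Sub.ren_congr {θ θ' : Ren} {A : Beh Λ}
    (h : ∀ x ∈ A.fv, (Val.var x).ren θ = (Val.var x).ren θ') : Sub (.ren θ A) (.ren θ' A) :=
  (inv_ren θ).sub (fwd_ren θ') A fun l m hl f => ⟨l, .refl l, by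
    unfold renLab; rwa [← Lab.ren_congr fun x hx => h x (hl x hx)]⟩

theorem Sub.ren_nil (A : Beh Λ) : Sub (.ren [] A) A := by
  refine (inv_ren []).sub Fwd.id A fun l m _ f => ⟨m, ?_, rfl⟩
  rwa [renLab, Lab.ren_nil] at f

theorem Sub.ren_id {θ : Ren} {A : Beh Λ} (h : ∀ x ∈ A.fv, (Val.var x).ren θ = .var x) :
    Sub (.ren θ A) A :=
  (ren_congr fun x hx => by rw [h x hx, Val.ren_nil]).trans (ren_nil A)

theorem Lab.ren_ren {θ θ₁ θ₂ : Ren} {F : Finset Var} {l : Lab Λ} (hl : l.Over F)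
    (h : ∀ x ∈ F, ((Val.var x).ren θ₁).ren θ = (Val.var x).ren θ₂) :
    (l.ren θ₁).ren θ = l.ren θ₂ := by
  have h' : ∀ v ∈ l.target, (v.ren θ₁).ren θ = v.ren θ₂ := by
    rintro (x | b) hv
    · exact h x (hl x hv)
    · rfl
  cases l <;> simp [ren, target] at h' ⊢ <;> simp [h']

theorem Sub.ren_ren {θ θ₁ θ₂ : Ren} {A : Beh Λ}
    (h : ∀ x ∈ A.fv, ((Val.var x).ren θ₁).ren θ = (Val.var x).ren θ₂) :
    Sub (.ren θ (.ren θ₁ A)) (.ren θ₂ A) := by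
  refine ((inv_ren θ).comp (inv_ren θ₁)).sub (fwd_ren θ₂) A fun l m hl => ?_
  rintro ⟨k, f, f'⟩
  refine ⟨l, .refl l, ?_⟩
  unfold renLab at *
  rw [← Lab.ren_ren hl h]
  generalize l.ren θ₁ = j at f
  cases f with
  | refl => exact f'
  -- The inner renaming has already identified the two ends, and the outer one keeps them equal.
  | com x => cases f'; exact .com _

theorem Sub.le_ren_ren {θ θ₁ θ₂ : Ren} {A : Beh Λ}
    (h : ∀ x ∈ A.fv, ((Val.var x).ren θ₁).ren θ = (Val.var x).ren θ₂) :
    Sub (.ren θ₂ A) (.ren θ (.ren θ₁ A)) := by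
  refine (inv_ren θ₂).sub ((fwd_ren θ).comp (fwd_ren θ₁)) A fun l m hl f => ?_
  refine ⟨l, .refl l, _, .refl _, ?_⟩
  unfold renLab at *
  rwa [Lab.ren_ren hl h]

theorem Sub.ren_inp {θ : Ren} {x z} (A : Beh Λ) (h : (Val.var x).ren θ = .var z) :
    Sub (.inp z (.ren θ A)) (.ren θ (.inp x A)) := by
  refine .of_step fun l X t => ?_
  obtain ⟨rfl, rfl⟩ := t.inp_inv
  exact ⟨_, .of_tr (by simpa [Lab.ren, h] using (Tr.inp x A).ren θ), .refl _⟩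

theorem Sub.ren_out {θ : Ren} {x z} (A : Beh Λ) (h : (Val.var x).ren θ = .var z) :
    Sub (.out z (.ren θ A)) (.ren θ (.out x A)) := by
  refine .of_step fun l X t => ?_
  obtain ⟨rfl, rfl⟩ := t.out_inv
  exact ⟨_, .of_tr (by simpa [Lab.ren, h] using (Tr.out x A).ren θ), .refl _⟩

theorem Sub.ren_acc {θ : Ren} {x z} (ξ) (A : Beh Λ) (h : (Val.var x).ren θ = .var z) :
    Sub (.acc ξ z (.ren θ A)) (.ren θ (.acc ξ x A)) := by
  refine .of_step fun l X t => ?_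
  obtain ⟨rfl, rfl⟩ := t.acc_inv
  exact ⟨_, .of_tr (by simpa [Lab.ren, h] using (Tr.acc ξ x A).ren θ), .refl _⟩

theorem renLab_inp {θ : Ren} {l : Lab Λ} {v} (h : renLab θ l (.inp v)) :
    ∃ w, l = .inp w ∧ w.ren θ = v := by
  unfold renLab at h
  generalize e : l.ren θ = j at h
  cases h
  cases l <;> simp [Lab.ren] at e ⊢
  exact e

theorem renLab_out {θ : Ren} {l : Lab Λ} {v} (h : renLab θ l (.out v)) :
    ∃ w, l = .out w ∧ w.ren θ = v := by
  unfold renLab at h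
  generalize e : l.ren θ = j at h
  cases h
  cases l <;> simp [Lab.ren] at e ⊢
  exact e

/-- Labels `{x, ȳ}` with `x ≠ y` exist for this law: two ends that become equal only after the
renaming already synchronize below it. -/
theorem Sub.ren_par (θ) (A B : Beh Λ) :
    Sub (.par (.ren θ A) (.ren θ B)) (.ren θ (.par A B)) := by
  refine ⟨fun X Y => ∃ A B, X = .par (.ren θ A) (.ren θ B) ∧ Y = .ren θ (.par A B), ?_,
    A, B, rfl, rfl⟩
  rintro _ _ ⟨A, B, rfl, rfl⟩ l X t₀
  rcases t₀.par_inv with ⟨A', t, rfl⟩ | ⟨B', t, rfl⟩ | ⟨A', B', x, y, t, t', f, rfl⟩ |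
      ⟨A', B', x, y, t, t', f, rfl⟩
  · obtain ⟨l', A', t₁, g, rfl⟩ := inv_ren θ t
    exact ⟨_, .of_tr (fwd_ren θ (t₁.parL B) g), _, _, rfl, rfl⟩
  · obtain ⟨l', A', t₁, g, rfl⟩ := inv_ren θ t
    exact ⟨_, .of_tr (fwd_ren θ (t₁.parR A) g), _, _, rfl, rfl⟩
  · obtain ⟨l₁, A', t₁, g, rfl⟩ := inv_ren θ t
    obtain ⟨l₂, B', t₂, g', rfl⟩ := inv_ren θ t'
    obtain ⟨v, rfl, rfl⟩ := renLab_inp g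
    obtain ⟨w, rfl, rfl⟩ := renLab_out g'
    exact ⟨_, .of_tr (fwd_ren θ (t₁.par2L t₂) f), _, _, rfl, rfl⟩
  · obtain ⟨l₁, A', t₁, g, rfl⟩ := inv_ren θ t
    obtain ⟨l₂, B', t₂, g', rfl⟩ := inv_ren θ t'
    obtain ⟨v, rfl, rfl⟩ := renLab_out g
    obtain ⟨w, rfl, rfl⟩ := renLab_inp g'
    exact ⟨_, .of_tr (fwd_ren θ (t₁.par2R t₂) f), _, _, rfl, rfl⟩

theorem Sub.par_ren (θ) (A B : Beh Λ) :
    Sub (.ren θ (.par A B)) (.par (.ren θ A) (.ren θ B)) := by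
  refine ⟨fun Y X => ∃ A B, X = .par (.ren θ A) (.ren θ B) ∧ Y = .ren θ (.par A B), ?_,
    A, B, rfl, rfl⟩
  rintro _ _ ⟨A, B, rfl, rfl⟩ m X t₀
  obtain ⟨l, Y, t₁, g, rfl⟩ := inv_ren θ t₀
  rcases t₁.par_inv with ⟨A', t, rfl⟩ | ⟨B', t, rfl⟩ | ⟨A', B', x, y, t, t', f, rfl⟩ |
      ⟨A', B', x, y, t, t', f, rfl⟩
  · exact ⟨_, .of_tr ((fwd_ren θ t g).parL _), _, _, rfl, rfl⟩
  · exact ⟨_, .of_tr ((fwd_ren θ t g).parR _), _, _, rfl, rfl⟩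
  · have : ((Lab.com x y).ren θ).Fire m := by
      cases f with
      | refl => exact g
      | com c => rw [eq_tau_of_renLab g]; exact .com _
    exact ⟨_, .of_tr (((t.ren θ).par2L (t'.ren θ)).fire this), _, _, rfl, rfl⟩
  · have : ((Lab.com x y).ren θ).Fire m := by
      cases f with
      | refl => exact g
      | com c => rw [eq_tau_of_renLab g]; exact .com _
    exact ⟨_, .of_tr (((t.ren θ).par2R (t'.ren θ)).fire this), _, _, rfl, rfl⟩

/-- By `Sub.rep_le` it suffices that the renamed replication absorbs the renamed `A`, which follows
by moving the renaming out of the composition. -/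
theorem Sub.ren_rep (θ) (A : Beh Λ) : Sub (.rep (.ren θ A)) (.ren θ (.rep A)) :=
  .rep_le ((ren_par θ A _).trans (.ren θ (.par_rep A)))

/-- `θ'` renames the variables in `S` to those in `S'`. -/
def Maps (θ' : Ren) (F S S' : Finset Var) : Prop :=
  ∀ x ∈ F, (Val.var x).ren θ' ∈ varSet S' ↔ x ∈ S

theorem Maps.val {θ' : Ren} {F S S' : Finset Var} (h : Maps θ' F S S') {l : Lab Λ}
    (hl : l.Over F) : ∀ v ∈ l.target, v.ren θ' ∈ varSet S' ↔ v ∈ varSet S := by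
  rintro (x | b) hv
  · rw [h x (hl x hv), mem_varSet]
  · simp [Val.ren, bool_not_mem_varSet]

theorem Maps.disjoint {θ' : Ren} {F S S' : Finset Var} (h : Maps θ' F S S') {l : Lab Λ}
    (hl : l.Over F) (d : Disjoint (l.ren θ').target (varSet S')) :
    Disjoint l.target (varSet S) := by
  rw [Lab.target_ren, Set.disjoint_left] at d
  rw [Set.disjoint_left]
  exact fun v hv hv' => d ⟨v, hv, rfl⟩ ((h.val hl v hv).2 hv')

theorem Maps.subset {θ' : Ren} {F S S' : Finset Var} (h : Maps θ' F S S') {l : Lab Λ}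
    (hl : l.Over F) (d : (l.ren θ').target ⊆ varSet S') : l.target ⊆ varSet S := by
  rw [Lab.target_ren] at d
  exact fun v hv => (h.val hl v hv).1 (d ⟨v, hv, rfl⟩)

theorem Maps.ren_eq {θ θ' : Ren} {F S : Finset Var}
    (e : ∀ x ∈ F, x ∉ S → (Val.var x).ren θ' = (Val.var x).ren θ) {l : Lab Λ}
    (hl : l.Over F) (d : Disjoint l.target (varSet S)) : l.ren θ' = l.ren θ :=
  Lab.ren_congr fun x hx => e x (hl x hx) fun h => Set.disjoint_left.1 d hx (mem_varSet.2 h)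

/-- If a renaming makes the two ends of a communication equal, then both ends are in `S`, or
none is. -/
theorem Maps.com {θ' : Ren} {F S S' : Finset Var} (h : Maps θ' F S S') {l : Lab Λ}
    (hl : l.Over F) {c} (e : l.ren θ' = .com c c) :
    Disjoint l.target (varSet S) ∨ l.target ⊆ varSet S := by
  by_cases hc : c ∈ varSet S'
  · exact Or.inr (h.subset hl (by simp [e, Lab.target, hc]))
  · exact Or.inl (h.disjoint hl (by simp [e, Lab.target, hc]))

/-- Here `θ'` is the renaming under a binder of `S`, whose names become `S'`, and `θ` is the one
seen outside. If `θ'` identifies the ends of a communication, both ends are in `S` or both are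
outside, so the label is never blocked by `↑_S`. -/
theorem Sub.excl_ren {θ θ' : Ren} {A : Beh Λ} {S S' : Finset Var} (h : Maps θ' A.fv S S')
    (e : ∀ x ∈ A.fv, x ∉ S → (Val.var x).ren θ' = (Val.var x).ren θ) :
    Sub (.excl (.ren θ' A) S') (.ren θ (.excl A S)) := by
  refine ((inv_excl S').comp (inv_ren θ')).sub ((fwd_ren θ).comp (fwd_excl S)) A fun l m hl => ?_
  rintro ⟨k, f, g⟩
  refine ⟨l, .refl l, ?_⟩
  unfold renLab at f
  generalize ej : l.ren θ' = j at f
  cases f with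
  | refl =>
    subst ej
    rcases g with ⟨rfl, d⟩ | ⟨rfl, d⟩
    · have d' := h.disjoint hl d
      exact ⟨l, Or.inl ⟨rfl, d'⟩, by rw [Maps.ren_eq e hl d']; exact .refl _⟩
    · exact ⟨.tau, Or.inr ⟨rfl, h.subset hl d⟩, .refl _⟩
  | com c =>
    obtain rfl : m = .tau := g.elim And.left And.left
    rcases h.com hl ej with d | d
    · refine ⟨l, Or.inl ⟨rfl, d⟩, ?_⟩
      unfold renLab
      rw [← Maps.ren_eq e hl d, ej]
      exact .com c
    · exact ⟨.tau, Or.inr ⟨rfl, d⟩, .refl _⟩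

theorem Sub.proj_ren {θ : Ren} {A : Beh Λ} {S S' : Finset Var} (h : Maps θ A.fv S S') :
    Sub (.proj (.ren θ A) S') (.ren θ (.proj A S)) := by
  refine ((inv_proj S').comp (inv_ren θ)).sub ((fwd_ren θ).comp (fwd_proj S)) A fun l m hl => ?_
  rintro ⟨k, f, g⟩
  refine ⟨l, .refl l, ?_⟩
  unfold renLab at f
  generalize ej : l.ren θ = j at f
  cases f with
  | refl =>
    subst ej
    rcases g with ⟨rfl, d⟩ | ⟨rfl, d⟩
    · exact ⟨.tau, Or.inl ⟨rfl, h.disjoint hl d⟩, .refl _⟩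
    · exact ⟨l, Or.inr ⟨rfl, h.subset hl d⟩, .refl _⟩
  | com c =>
    obtain rfl : m = .tau := g.elim And.left And.left
    rcases h.com hl ej with d | d
    · exact ⟨.tau, Or.inl ⟨rfl, d⟩, .refl _⟩
    · refine ⟨l, Or.inr ⟨rfl, d⟩, ?_⟩
      unfold renLab
      rw [ej]
      exact .com c

theorem Lab.eq_com_of_ren {θ : Ren} {l : Lab Λ} {v w} (h : l.ren θ = .com v w) :
    ∃ a b, l = .com a b := by
  cases l <;> simp [ren] at h ⊢

theorem Sub.nu_ren {θ θ' : Ren} {A : Beh Λ} {x x' : Var} (h : Maps θ' A.fv {x} {x'})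
    (e : ∀ z ∈ A.fv, z ∉ ({x} : Finset Var) → (Val.var z).ren θ' = (Val.var z).ren θ) :
    Sub (.nu x' (.ren θ' A)) (.ren θ (.nu x A)) := by
  refine ((inv_nu x').comp (inv_ren θ')).sub ((fwd_ren θ).comp (fwd_nu x)) A fun l m hl => ?_
  rintro ⟨k, f, g⟩
  unfold renLab at f
  generalize ej : l.ren θ' = j at f
  cases f with
  | refl =>
    subst ej
    obtain ⟨rfl, d⟩ := g
    have d' := h.disjoint hl d
    exact ⟨l, .refl l, l, ⟨rfl, d'⟩, by rw [Maps.ren_eq e hl d']; exact .refl _⟩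
  | com c =>
    obtain rfl : m = .tau := g.1
    rcases h.com hl ej with d | d
    · refine ⟨l, .refl l, l, ⟨rfl, d⟩, ?_⟩
      unfold renLab
      rw [← Maps.ren_eq e hl d, ej]
      exact .com c
    -- Both ends are `x`. The label `{x, x̄}` itself is blocked by `(νx)`, but it has already fired
    -- as `τ` below the restriction.
    · obtain ⟨a, b, rfl⟩ := Lab.eq_com_of_ren ej
      have hs : varSet {x} = {Val.var x} := by simp [varSet]
      rw [hs] at d
      obtain rfl : a = .var x := d (by simp [Lab.target])
      obtain rfl : b = .var x := d (by simp [Lab.target])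
      exact ⟨.tau, .com _, .tau, nuLab_tau x, .refl _⟩

/-! # Laws of restriction -/

theorem Sub.nu_le (x) (A : Beh Λ) : Sub (.nu x A) A :=
  (inv_nu x).sub Fwd.id A fun l _ _ h => ⟨l, .refl l, h.1.symm⟩

theorem Sub.le_nu {x} {A : Beh Λ} (h : x ∉ A.fv) : Sub A (.nu x A) :=
  Inv.id.sub (fwd_nu x) A fun l m hl e => ⟨l, .refl l, e.symm, by
    rw [Set.disjoint_left]
    rintro _ hv ⟨z, hz, rfl⟩
    obtain rfl : z = x := by simpa using hz
    exact h (hl _ hv)⟩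

theorem Sub.nu_nu (x y) (A : Beh Λ) : Sub (.nu x (.nu y A)) (.nu y (.nu x A)) := by
  refine ((inv_nu x).comp (inv_nu y)).sub ((fwd_nu y).comp (fwd_nu x)) A fun l m _ => ?_
  rintro ⟨k, ⟨rfl, d⟩, ⟨rfl, d'⟩⟩
  exact ⟨_, .refl _, _, ⟨rfl, d'⟩, rfl, d⟩

theorem Sub.excl_nu (x S) (A : Beh Λ) :
    Sub (.excl (.nu x A) S) (.nu x (.excl A S)) := by
  refine ((inv_excl S).comp (inv_nu x)).sub ((fwd_nu x).comp (fwd_excl S)) A fun l _ _ => ?_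
  rintro ⟨k, ⟨rfl, d⟩, (⟨rfl, d'⟩ | ⟨rfl, d'⟩)⟩
  · exact ⟨_, .refl _, _, Or.inl ⟨rfl, d'⟩, rfl, d⟩
  · exact ⟨_, .refl _, _, Or.inr ⟨rfl, d'⟩, nuLab_tau x⟩

theorem disjoint_varSet_singleton {v : Val} {x : Var} :
    Disjoint ({v} : Set Val) (varSet {x}) ↔ v ≠ .var x := by
  simp [varSet]

theorem Sub.nu_inp {x z} (A : Beh Λ) (h : z ≠ x) :
    Sub (.inp z (.nu x A)) (.nu x (.inp z A)) := by
  refine .of_step fun l X t => ?_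
  obtain ⟨rfl, rfl⟩ := t.inp_inv
  exact ⟨_, .of_tr ((Tr.inp z A).nu x (disjoint_varSet_singleton.2 (by simpa using h))), .refl _⟩

theorem Sub.nu_out {x z} (A : Beh Λ) (h : z ≠ x) :
    Sub (.out z (.nu x A)) (.nu x (.out z A)) := by
  refine .of_step fun l X t => ?_
  obtain ⟨rfl, rfl⟩ := t.out_inv
  exact ⟨_, .of_tr ((Tr.out z A).nu x (disjoint_varSet_singleton.2 (by simpa using h))), .refl _⟩

theorem Sub.nu_acc {x z} (ξ) (A : Beh Λ) (h : z ≠ x) :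
    Sub (.acc ξ z (.nu x A)) (.nu x (.acc ξ z A)) := by
  refine .of_step fun l X t => ?_
  obtain ⟨rfl, rfl⟩ := t.acc_inv
  exact ⟨_, .of_tr ((Tr.acc ξ z A).nu x (disjoint_varSet_singleton.2 (by simpa using h))),
    .refl _⟩

theorem Sub.nu_par (x) (A B : Beh Λ) :
    Sub (.par (.nu x A) (.nu x B)) (.nu x (.par A B)) := by
  have key {a b : Val} (h : Disjoint ({a} : Set Val) (varSet {x}))
      (h' : Disjoint ({b} : Set Val) (varSet {x})) {l : Lab Λ} (f : (Lab.com a b).Fire l) :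
      nuLab x l l := by
    refine ⟨rfl, ?_⟩
    cases f with
    | refl =>
      rw [Lab.target, Set.insert_eq]
      exact h.union_left h'
    | com => exact (nuLab_tau (Λ := Λ) x).2
  refine ⟨fun X Y => ∃ A B, X = .par (.nu x A) (.nu x B) ∧ Y = .nu x (.par A B), ?_,
    A, B, rfl, rfl⟩
  rintro _ _ ⟨A, B, rfl, rfl⟩ l X t₀
  rcases t₀.par_inv with ⟨A', t, rfl⟩ | ⟨B', t, rfl⟩ | ⟨A', B', a, b, t, t', f, rfl⟩ |
      ⟨A', B', a, b, t, t', f, rfl⟩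
  · obtain ⟨l', A', t₁, g, rfl⟩ := inv_nu x t
    exact ⟨_, .of_tr (fwd_nu x (t₁.parL B) g), _, _, rfl, rfl⟩
  · obtain ⟨l', A', t₁, g, rfl⟩ := inv_nu x t
    exact ⟨_, .of_tr (fwd_nu x (t₁.parR A) g), _, _, rfl, rfl⟩
  · obtain ⟨l₁, A', t₁, ⟨rfl, d⟩, rfl⟩ := inv_nu x t
    obtain ⟨l₂, B', t₂, ⟨rfl, d'⟩, rfl⟩ := inv_nu x t'
    exact ⟨_, .of_tr (fwd_nu x ((t₁.par2L t₂).fire f) (key d d' f)), _, _, rfl, rfl⟩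
  · obtain ⟨l₁, A', t₁, ⟨rfl, d⟩, rfl⟩ := inv_nu x t
    obtain ⟨l₂, B', t₂, ⟨rfl, d'⟩, rfl⟩ := inv_nu x t'
    exact ⟨_, .of_tr (fwd_nu x ((t₁.par2R t₂).fire f) (key d' d f)), _, _, rfl, rfl⟩

theorem Sub.nu_rep (x) (A : Beh Λ) : Sub (.rep (.nu x A)) (.nu x (.rep A)) :=
  .rep_le ((nu_par x A _).trans (.nu x (.par_rep A)))

/-! # Scope extrusion -/

theorem Lab.eq_tau_of_disjoint {l : Lab Λ} {S : Set Val} (h : Disjoint l.target S)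
    (h' : l.target ⊆ S) : l = .tau := by
  have : l.target = ∅ := by simpa using h.eq_bot_of_le h'
  cases l <;> first | rfl | exact absurd this (Set.insert_nonempty _ _).ne_empty | skip
  all_goals exact absurd this (Set.singleton_ne_empty _)

/-- A communication with only one end at `x` remains visible. -/
theorem Lab.Fire.com_cases {a b : Val} {k : Lab Λ} (f : (Lab.com a b).Fire k) {x : Var}
    (h : a ≠ .var x ∨ b ≠ .var x) :
    (a ≠ .var x ∧ b ≠ .var x ∧ Disjoint k.target (varSet {x})) ∨
      (¬ Disjoint k.target (varSet {x}) ∧ ¬ k.target ⊆ varSet {x}) := by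
  cases f <;> simp [target, varSet] <;> grind

/-- A restricted `B` offers nothing at `x`. So a synchronization with an action of `A` at `x`
carries a label `{x, ȳ}` or `{y, x̄}` with `y ≠ x`, which is not silent and is blocked by the outer
restriction. -/
theorem Sub.nu_par_extrude (x) (A B : Beh Λ) :
    Sub (.nu x (.par A (.nu x B))) (.par (.nu x A) (.nu x B)) := by
  refine ⟨fun X Y => ∃ A B, X = .nu x (.par A (.nu x B)) ∧ Y = .par (.nu x A) (.nu x B), ?_,
    A, B, rfl, rfl⟩
  rintro _ _ ⟨A, B, rfl, rfl⟩ m X t₀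
  obtain ⟨l, Y, t₁, ⟨rfl, d⟩, rfl⟩ := inv_nu x t₀
  rcases t₁.par_inv with ⟨A', t, rfl⟩ | ⟨_, t, rfl⟩ | ⟨A', _, a, b, t, t', f, rfl⟩ |
      ⟨A', _, a, b, t, t', f, rfl⟩
  · exact ⟨_, .of_tr ((t.nu x d).parL _), _, _, rfl, rfl⟩
  · obtain ⟨_, B', _, _, rfl⟩ := inv_nu x t
    exact ⟨_, .of_tr (t.parR _), _, _, rfl, rfl⟩
  · obtain ⟨_, B', _, ⟨rfl, d'⟩, rfl⟩ := inv_nu x t'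
    rcases f.com_cases (Or.inr (disjoint_varSet_singleton.1 d')) with ⟨ha, -, -⟩ | ⟨h, -⟩
    · exact ⟨_, .of_tr (((t.nu x (disjoint_varSet_singleton.2 ha)).par2L t').fire f),
        _, _, rfl, rfl⟩
    · exact absurd d h
  · obtain ⟨_, B', _, ⟨rfl, d'⟩, rfl⟩ := inv_nu x t'
    rcases f.com_cases (Or.inl (disjoint_varSet_singleton.1 d')) with ⟨-, ha, -⟩ | ⟨h, -⟩
    · exact ⟨_, .of_tr (((t.nu x (disjoint_varSet_singleton.2 ha)).par2R t').fire f),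
        _, _, rfl, rfl⟩
    · exact absurd d h

/-- A synchronization with just one end at `x` has a target neither disjoint from `{x}` nor
contained in it, so exclusion blocks it. Every remaining move of `(νx)B` keeps its label. -/
theorem Sub.excl_par_extrude (x) (A B : Beh Λ) :
    Sub (.excl (.par A (.nu x B)) {x}) (.par (.excl A {x}) (.nu x B)) := by
  refine ⟨fun X Y => ∃ A B, X = .excl (.par A (.nu x B)) {x} ∧
    Y = .par (.excl A {x}) (.nu x B), ?_, A, B, rfl, rfl⟩
  rintro _ _ ⟨A, B, rfl, rfl⟩ m X t₀
  obtain ⟨l, Y, t₁, g, rfl⟩ := inv_excl {x} t₀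
  rcases t₁.par_inv with ⟨A', t, rfl⟩ | ⟨_, t, rfl⟩ | ⟨A', _, a, b, t, t', f, rfl⟩ |
      ⟨A', _, a, b, t, t', f, rfl⟩
  · exact ⟨_, .of_tr ((fwd_excl {x} t g).parL _), _, _, rfl, rfl⟩
  · obtain ⟨_, B', _, ⟨rfl, d⟩, rfl⟩ := inv_nu x t
    have : m = l := g.elim And.left fun h => h.1.trans (Lab.eq_tau_of_disjoint d h.2).symm
    subst this
    exact ⟨_, .of_tr (t.parR _), _, _, rfl, rfl⟩
  · obtain ⟨_, B', _, ⟨rfl, d'⟩, rfl⟩ := inv_nu x t'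
    rcases f.com_cases (Or.inr (disjoint_varSet_singleton.1 d')) with ⟨ha, -, d⟩ | ⟨h, h'⟩
    · have : m = l := g.elim And.left fun h => h.1.trans (Lab.eq_tau_of_disjoint d h.2).symm
      subst this
      exact ⟨_, .of_tr (((t.exclOut {x} (disjoint_varSet_singleton.2 ha)).par2L t').fire f),
        _, _, rfl, rfl⟩
    · exact (g.elim (fun g => h g.2) fun g => h' g.2).elim
  · obtain ⟨_, B', _, ⟨rfl, d'⟩, rfl⟩ := inv_nu x t'
    rcases f.com_cases (Or.inl (disjoint_varSet_singleton.1 d')) with ⟨-, ha, d⟩ | ⟨h, h'⟩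
    · have : m = l := g.elim And.left fun h => h.1.trans (Lab.eq_tau_of_disjoint d h.2).symm
      subst this
      exact ⟨_, .of_tr (((t.exclOut {x} (disjoint_varSet_singleton.2 ha)).par2R t').fire f),
        _, _, rfl, rfl⟩
    · exact (g.elim (fun g => h g.2) fun g => h' g.2).elim

/-- Moves of `(νx)B` alone avoid `x`, so they are silent and are answered by no move. This shows
that extruding the scope of a resource adds no traces. -/
theorem Sub.proj_par_extrude (x) (A B : Beh Λ) :
    Sub (.proj (.par A (.nu x B)) {x}) (.proj A {x}) := by
  refine ⟨fun X Y => ∃ A B, X = .proj (.par A (.nu x B)) {x} ∧ Y = .proj A {x}, ?_,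
    A, B, rfl, rfl⟩
  rintro _ _ ⟨A, B, rfl, rfl⟩ m X t₀
  obtain ⟨l, Y, t₁, g, rfl⟩ := inv_proj {x} t₀
  rcases t₁.par_inv with ⟨A', t, rfl⟩ | ⟨_, t, rfl⟩ | ⟨A', _, a, b, t, t', f, rfl⟩ |
      ⟨A', _, a, b, t, t', f, rfl⟩
  · exact ⟨_, .of_tr (fwd_proj {x} t g), _, _, rfl, rfl⟩
  · obtain ⟨_, B', _, ⟨rfl, d⟩, rfl⟩ := inv_nu x t
    have : m = .tau := g.elim And.left fun h => h.1.trans (Lab.eq_tau_of_disjoint d h.2)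
    subst this
    exact ⟨_, Taus.wtr .refl, _, _, rfl, rfl⟩
  · obtain ⟨_, B', _, ⟨rfl, d'⟩, rfl⟩ := inv_nu x t'
    rcases f.com_cases (Or.inr (disjoint_varSet_singleton.1 d')) with ⟨ha, -, d⟩ | ⟨h, h'⟩
    · have : m = .tau := g.elim And.left fun h => h.1.trans (Lab.eq_tau_of_disjoint d h.2)
      subst this
      exact ⟨_, .of_tr (t.projOut {x} (disjoint_varSet_singleton.2 ha)), _, _, rfl, rfl⟩
    · exact (g.elim (fun g => h g.2) fun g => h' g.2).elim
  · obtain ⟨_, B', _, ⟨rfl, d'⟩, rfl⟩ := inv_nu x t'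
    rcases f.com_cases (Or.inl (disjoint_varSet_singleton.1 d')) with ⟨-, ha, d⟩ | ⟨h, h'⟩
    · have : m = .tau := g.elim And.left fun h => h.1.trans (Lab.eq_tau_of_disjoint d h.2)
      subst this
      exact ⟨_, .of_tr (t.projOut {x} (disjoint_varSet_singleton.2 ha)), _, _, rfl, rfl⟩
    · exact (g.elim (fun g => h g.2) fun g => h' g.2).elim

/-! # Splitting a behavior by a set of variables -/

/-- Only the two synchronization rules create a label `{a, b̄}`, from two independent components
that can also move one after the other. The remaining rules carry both steps along, since a side
condition on `{a, b}` gives it for `{a}` and for `{b}`. -/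
theorem Tr.com_split {A A' : Beh Λ} {a b} (h : Tr A (.com a b) A') :
    (∃ B, Tr A (.inp a) B ∧ Tr B (.out b) A') ∧ ∃ B, Tr A (.out b) B ∧ Tr B (.inp a) A' := by
  have disj {a b : Val} {S : Set Val} (d : Disjoint (Lab.com a b : Lab Λ).target S) :
      Disjoint (Lab.inp a : Lab Λ).target S ∧ Disjoint (Lab.out b : Lab Λ).target S := by
    rw [Lab.target, Set.insert_eq, Set.disjoint_union_left] at d
    exact d
  have subs {a b : Val} {S : Set Val} (d : (Lab.com a b : Lab Λ).target ⊆ S) :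
      (Lab.inp a : Lab Λ).target ⊆ S ∧ (Lab.out b : Lab Λ).target ⊆ S := by
    rw [Lab.target, Set.insert_eq, Set.union_subset_iff] at d
    exact d
  generalize e : Lab.com a b = l at h
  induction h generalizing a b with
  | parL C _ ih =>
    obtain ⟨⟨B, t₁, t₂⟩, B', u₁, u₂⟩ := ih e
    exact ⟨⟨_, t₁.parL C, t₂.parL C⟩, _, u₁.parL C, u₂.parL C⟩
  | parR C _ ih =>
    obtain ⟨⟨B, t₁, t₂⟩, B', u₁, u₂⟩ := ih e
    exact ⟨⟨_, t₁.parR C, t₂.parR C⟩, _, u₁.parR C, u₂.parR C⟩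
  | par2L t t' => cases e; exact ⟨⟨_, t.parL _, t'.parR _⟩, _, t'.parR _, t.parL _⟩
  | par2R t t' => cases e; exact ⟨⟨_, t'.parR _, t.parL _⟩, _, t.parL _, t'.parR _⟩
  | choiceL C _ ih =>
    obtain ⟨⟨B, t₁, t₂⟩, B', u₁, u₂⟩ := ih e
    exact ⟨⟨_, t₁.choiceL C, t₂⟩, _, u₁.choiceL C, u₂⟩
  | choiceR C _ ih =>
    obtain ⟨⟨B, t₁, t₂⟩, B', u₁, u₂⟩ := ih e
    exact ⟨⟨_, t₁.choiceR C, t₂⟩, _, u₁.choiceR C, u₂⟩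
  | rep _ ih =>
    obtain ⟨⟨B, t₁, t₂⟩, B', u₁, u₂⟩ := ih e
    exact ⟨⟨_, t₁.rep, t₂⟩, _, u₁.rep, u₂⟩
  | mu s _ ih =>
    obtain ⟨⟨B, t₁, t₂⟩, B', u₁, u₂⟩ := ih e
    exact ⟨⟨_, .mu s t₁, t₂⟩, _, .mu s u₁, u₂⟩
  | ren θ _ ih =>
    obtain ⟨a', b', rfl⟩ := Lab.eq_com_of_ren e.symm
    cases e
    obtain ⟨⟨B, t₁, t₂⟩, B', u₁, u₂⟩ := ih rfl
    exact ⟨⟨_, t₁.ren θ, t₂.ren θ⟩, _, u₁.ren θ, u₂.ren θ⟩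
  | nu x _ d ih =>
    subst e
    obtain ⟨⟨B, t₁, t₂⟩, B', u₁, u₂⟩ := ih rfl
    obtain ⟨d₁, d₂⟩ := disj d
    exact ⟨⟨_, t₁.nu x d₁, t₂.nu x d₂⟩, _, u₁.nu x d₂, u₂.nu x d₁⟩
  | exclOut S _ d ih =>
    subst e
    obtain ⟨⟨B, t₁, t₂⟩, B', u₁, u₂⟩ := ih rfl
    obtain ⟨d₁, d₂⟩ := disj d
    exact ⟨⟨_, t₁.exclOut S d₁, t₂.exclOut S d₂⟩, _, u₁.exclOut S d₂, u₂.exclOut S d₁⟩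
  | projIn S _ d ih =>
    subst e
    obtain ⟨⟨B, t₁, t₂⟩, B', u₁, u₂⟩ := ih rfl
    obtain ⟨d₁, d₂⟩ := subs d
    exact ⟨⟨_, t₁.projIn S d₁, t₂.projIn S d₂⟩, _, u₁.projIn S d₂, u₂.projIn S d₁⟩
  | _ => cases e

/-- The two copies of `A` move in step: one shows the action, the other does it silently. A label
with one end in `S` and one outside is blocked in both copies; it is split in two, and the pieces
shown by the two copies recombine into the original label. -/
theorem Sub.le_proj_par_excl (A : Beh Λ) (S : Finset Var) :
    Sub A (.par (.proj A S) (.excl A S)) := by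
  refine ⟨fun X Y => Y = .par (.proj X S) (.excl X S), ?_, rfl⟩
  rintro X _ rfl l X' t
  refine ⟨_, ?_, rfl⟩
  by_cases d : Disjoint l.target (varSet S)
  · exact .of_taus_left (.single ((t.projOut S d).parL _)) (.of_tr ((t.exclOut S d).parR _))
  by_cases i : l.target ⊆ varSet S
  · exact .of_taus_left (.single ((t.exclIn S i).parR _)) (.of_tr ((t.projIn S i).parL _))
  have single {v : Val} : Disjoint {v} (varSet S) ↔ v ∉ varSet S := Set.disjoint_singleton_left
  cases l with
  | com a b =>
    obtain ⟨⟨B, t₁, t₂⟩, B', u₁, u₂⟩ := t.com_split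
    by_cases ha : a ∈ varSet S
    · have hb : b ∉ varSet S := fun hb => i (by simp [Lab.target, Set.insert_subset_iff, ha, hb])
      -- The exclusion first hides the input at `a`. Then the projection shows that input while the
      -- exclusion shows the output at `b`, and finally the projection hides that output.
      refine .of_taus_left (.single ((t₁.exclIn S (by simpa [Lab.target])).parR _))
        (.of_taus_right (.of_tr ((t₁.projIn S (by simpa [Lab.target])).par2L
          (t₂.exclOut S (single.2 hb)))) (.single ((t₂.projOut S (single.2 hb)).parL _)))
    · have hb : b ∈ varSet S := by
        by_contra hb
        exact d (by simp [Lab.target, ha, hb])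
      refine .of_taus_left (.single ((u₁.exclIn S (by simpa [Lab.target])).parR _))
        (.of_taus_right (.of_tr ((u₁.projIn S (by simpa [Lab.target])).par2R
          (u₂.exclOut S (single.2 ha)))) (.single ((u₂.projOut S (single.2 ha)).parL _)))
  | tau => exact (d (by simp [Lab.target])).elim
  | _ =>
    simp only [Lab.target, Set.singleton_subset_iff] at d i
    exact (d (single.2 i)).elim

/-! # Renaming of processes -/

def Occ.ren (θ : Ren) : Occ → Occ
  | .val v => .val (v.ren θ)
  | .bvar i j => .bvar i j

theorem Occ.ren_inst (θ : Ren) (k : ℕ) (vs : List Val) (o : Occ) :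
    (o.inst k vs).ren θ = (o.ren θ).inst k (vs.map (Val.ren θ)) := by
  cases o with
  | val v => rfl
  | bvar i j =>
    by_cases h : i = k
    · cases e : vs[j]? <;> simp [inst, ren, h, e]
    · simp [inst, ren, h]

theorem Occ.ren_congr {θ θ' : Ren} {o : Occ}
    (h : ∀ x ∈ o.fv, (Val.var x).ren θ = (Val.var x).ren θ') : o.ren θ = o.ren θ' := by
  cases o with
  | val v =>
    cases v with
    | var x => exact congrArg Occ.val (h x (by simp [fv, Val.fv]))
    | bool b => rfl
  | bvar i j => rfl

theorem Occ.ren_nil (o : Occ) : o.ren [] = o := by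
  cases o <;> simp [ren, Val.ren_nil]

theorem Occ.mem_fv_inst {k : ℕ} {vs : List Val} {o : Occ} {x : Var} (h : x ∈ (o.inst k vs).fv) :
    x ∈ o.fv ∨ ∃ v ∈ vs, x ∈ v.fv := by
  cases o with
  | val v => exact Or.inl h
  | bvar i j =>
    simp only [inst] at h
    split at h
    · cases e : vs[j]? with
      | none => simp [e, fv] at h
      | some v =>
        simp only [e] at h
        exact Or.inr ⟨v, List.mem_of_getElem? e, h⟩
    · simp [fv] at h

theorem Occ.mem_foldr_fv {vs : List Occ} {x : Var} :
    x ∈ vs.foldr (fun v s => v.fv ∪ s) ∅ ↔ ∃ v ∈ vs, x ∈ v.fv := by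
  induction vs with
  | nil => simp
  | cons v vs ih => simp [ih]

theorem Occ.inst_of_lcAt {c : List ℕ} {o : Occ} (h : o.LCAt c) {k : ℕ} (hk : c.length ≤ k)
    (vs : List Val) : o.inst k vs = o := by
  cases o with
  | val v => rfl
  | bvar i j =>
    obtain ⟨n, hn, -⟩ := h
    have := (List.getElem?_eq_some_iff.1 hn).1
    rw [inst, if_neg (by omega)]

namespace Proc

/-- Bound variables are indices, so there is no capture to avoid. -/
def ren (θ : Ren) : Proc Λ → Proc Λ
  | nil => nil
  | out x vs P => out (x.ren θ) (vs.map (Occ.ren θ)) (P.ren θ)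
  | inp x n P => inp (x.ren θ) n (P.ren θ)
  | par P Q => par (P.ren θ) (Q.ren θ)
  | ite v P Q => ite (v.ren θ) (P.ren θ) (Q.ren θ)
  | nu P => nu (P.ren θ)
  | rep P => rep (P.ren θ)
  | acc ξ x P => acc ξ (x.ren θ) (P.ren θ)
  | nuR Φ P => nuR Φ (P.ren θ)

theorem ren_inst (θ : Ren) (vs : List Val) (P : Proc Λ) : ∀ k,
    (P.inst k vs).ren θ = (P.ren θ).inst k (vs.map (Val.ren θ)) := by
  induction P <;> intro k <;> simp_all [ren, inst, Occ.ren_inst]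

theorem ren_congr {θ θ' : Ren} {P : Proc Λ}
    (h : ∀ x ∈ P.fv, (Val.var x).ren θ = (Val.var x).ren θ') : P.ren θ = P.ren θ' := by
  induction P with
  | out x vs P ih =>
    simp only [fv, Finset.mem_union, Occ.mem_foldr_fv] at h
    simp only [ren, out.injEq, List.map_inj_left]
    exact ⟨Occ.ren_congr fun y hy => h y (Or.inl (Or.inl hy)),
      fun o ho => Occ.ren_congr fun y hy => h y (Or.inl (Or.inr ⟨o, ho, hy⟩)),
      ih fun y hy => h y (Or.inr hy)⟩
  | inp x n P ih =>
    simp only [fv, Finset.mem_union] at h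
    simp only [ren, ih fun y hy => h y (Or.inr hy), Occ.ren_congr fun y hy => h y (Or.inl hy)]
  | acc ξ x P ih =>
    simp only [fv, Finset.mem_union] at h
    simp only [ren, ih fun y hy => h y (Or.inr hy), Occ.ren_congr fun y hy => h y (Or.inl hy)]
  | ite v P Q ih ih' =>
    simp only [fv, Finset.mem_union] at h
    simp only [ren, ih fun y hy => h y (Or.inl (Or.inr hy)), ih' fun y hy => h y (Or.inr hy),
      Occ.ren_congr fun y hy => h y (Or.inl (Or.inl hy))]
  | par P Q ih ih' =>
    simp only [fv, Finset.mem_union] at h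
    simp only [ren, ih fun y hy => h y (Or.inl hy), ih' fun y hy => h y (Or.inr hy)]
  | nil => rfl
  | _ => simp_all [ren, fv]

theorem ren_nil (P : Proc Λ) : P.ren [] = P := by
  have : Occ.ren [] = id := funext Occ.ren_nil
  induction P <;> simp_all [ren]

theorem ren_id {θ : Ren} {P : Proc Λ} (h : ∀ x ∈ P.fv, (Val.var x).ren θ = .var x) :
    P.ren θ = P := by
  rw [ren_congr (θ' := []) fun x hx => by rw [h x hx, Val.ren_nil], ren_nil]

theorem mem_fv_inst {vs : List Val} {P : Proc Λ} {x : Var} :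
    ∀ {k}, x ∈ (P.inst k vs).fv → x ∈ P.fv ∨ ∃ v ∈ vs, x ∈ v.fv := by
  have o {o : Occ} {k} := @Occ.mem_fv_inst k vs o x
  induction P with
  | out y ws P ih =>
    intro k h
    simp only [inst, fv, Finset.mem_union, Occ.mem_foldr_fv, List.mem_map] at h ⊢
    rcases h with (h | ⟨_, ⟨w, hw, rfl⟩, h⟩) | h
    · exact (o h).imp_left fun h => Or.inl (Or.inl h)
    · exact (o h).imp_left fun h => Or.inl (Or.inr ⟨w, hw, h⟩)
    · exact (ih h).imp_left Or.inr
  | _ => simp only [inst, fv, Finset.mem_union] at *; grind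

theorem mem_fv_withNames {ys : List Var} {P : Proc Λ} {x : Var} (h : x ∈ (P.withNames ys).fv) :
    x ∈ P.fv ∨ x ∈ ys := by
  refine (mem_fv_inst h).imp_right ?_
  rintro ⟨v, hv, hx⟩
  obtain ⟨y, hy, rfl⟩ := List.mem_map.1 hv
  obtain rfl : x = y := by simpa [Val.fv] using hx
  exact hy

theorem not_mem_fv_withNames {y x : Var} {P : Proc Λ} (h : x ∉ P.fv) (hxy : x ≠ y) :
    x ∉ (P.withNames [y]).fv :=
  fun h' => (mem_fv_withNames h').elim h (by simpa using hxy)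

theorem safe_inst (vs : List Val) (P : Proc Λ) : ∀ k, (P.inst k vs).Safe ↔ P.Safe := by
  induction P <;> intro k <;> simp_all [inst, Safe]

theorem safe_withNames (ys : List Var) (P : Proc Λ) : (P.withNames ys).Safe ↔ P.Safe :=
  safe_inst _ P 0

/-- All indices in `P` point to binders below `c.length ≤ k`, so none denotes the `k`-th binder. In
scope extrusion this makes `Q` insensitive to the binder it enters. -/
theorem inst_of_lcAt {P : Proc Λ} (vs : List Val) : ∀ {c k}, P.LCAt c → c.length ≤ k →
    P.inst k vs = P := by
  have o {o : Occ} {c} (h : o.LCAt c) {k} (hk : c.length ≤ k) := Occ.inst_of_lcAt h hk vs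
  induction P with
  | out y ws P ih =>
    intro c k h hk
    simp only [LCAt] at h
    rw [inst, o h.1 hk, ih h.2.2 hk, List.map_congr_left fun w hw => o (h.2.1 w hw) hk,
      List.map_id']
  | inp x n P ih =>
    intro c k h hk
    rw [inst, o h.1 hk, ih h.2 (by simpa using hk)]
  | nu P ih =>
    intro c k h hk
    rw [inst, ih (c := 1 :: c) h (by simpa using hk)]
  | nuR Φ P ih =>
    intro c k h hk
    rw [inst, ih (c := 1 :: c) h (by simpa using hk)]
  | nil => intros; rfl
  | _ => intro c k h hk; simp only [LCAt, inst] at *; grind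

theorem LC.withNames {P : Proc Λ} (h : P.LC) (ys : List Var) : P.withNames ys = P :=
  inst_of_lcAt _ h le_rfl

end Proc

theorem SP.safe {P Q : Proc Λ} (h : SP P Q) : P.Safe → Q.Safe := by
  induction h with
  | cNew x _ _ _ ih => simpa [Proc.Safe, Proc.safe_withNames] using ih
  | cNewR Φ x _ _ _ ih =>
    simp only [Proc.safe_withNames] at ih
    exact fun h => ⟨h.1, ih h.2⟩
  | trans _ _ ih ih' => exact fun h => ih' (ih h)
  | refl => exact id
  | _ => simp only [Proc.Safe] at *; tauto

/-! # Renaming of binders -/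

theorem exists_fresh (n : ℕ) (F : Finset Var) :
    ∃ ys : List Var, ys.length = n ∧ ys.Nodup ∧ ∀ y ∈ ys, y ∉ F := by
  -- Consecutive numbers just above the maximum of `F`.
  refine ⟨(List.range n).map (· + (F.sup id + 1)), by simp, ?_, ?_⟩
  · exact List.nodup_range.map fun a b h => by simpa using h
  · intro y hy hF
    obtain ⟨i, -, rfl⟩ := List.mem_map.1 hy
    have : i + (F.sup id + 1) ≤ F.sup id := Finset.le_sup (f := id) hF
    exact absurd ((Nat.le_add_left _ i).trans this) (Nat.not_succ_le_self _)

theorem lookup_zip_getElem {β : Type*} {ys : List Var} (h : ys.Nodup) {vs : List β} :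
    ∀ {i : ℕ} (hi : i < ys.length) (hi' : i < vs.length),
    (ys.zip vs).lookup ys[i] = some vs[i] := by
  induction ys generalizing vs with
  | nil => intro i hi; simp at hi
  | cons y ys ih =>
    cases vs with
    | nil => intro i _ hi; simp at hi
    | cons v vs =>
      rintro (_ | i) hi hi'
      · simp
      · simp only [List.getElem_cons_succ, List.zip_cons_cons, List.lookup_cons]
        rw [List.nodup_cons] at h
        rw [beq_false_of_ne fun e => h.1 (by rw [← e]; exact List.getElem_mem _)]
        exact ih h.2 _ _

theorem lookup_zip_of_not_mem {β : Type*} {ys : List Var} {y : Var} (h : y ∉ ys) (vs : List β) :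
    (ys.zip vs).lookup y = none := by
  rw [List.lookup_eq_none_iff]
  rintro ⟨a, b⟩ hp
  have := (List.of_mem_zip hp).1
  simp only [bne_iff_ne, ne_eq]
  rintro rfl
  exact h this

/-- The renaming `θ` under a binder, when the bound variables `ys` are renamed to `ys'`. -/
def Ren.under (ys ys' : List Var) (θ : Ren) : Ren := ys.zip (ys'.map Val.var) ++ θ

/-- Lookup returns the first match, so the pairs for `ys` shadow whatever `θ` does to these names.
-/
theorem Ren.under_getElem {ys ys' : List Var} (θ : Ren) (h : ys.Nodup) {i : ℕ}
    (hi : i < ys.length) (hi' : i < ys'.length) :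
    (Val.var ys[i]).ren (Ren.under ys ys' θ) = .var ys'[i] := by
  apply Val.ren_of_lookup
  rw [Ren.under, List.lookup_append, lookup_zip_getElem h hi (by simpa using hi')]
  simp

theorem Ren.under_of_not_mem {ys : List Var} (ys' : List Var) (θ : Ren) {x : Var} (h : x ∉ ys) :
    (Val.var x).ren (Ren.under ys ys' θ) = (Val.var x).ren θ := by
  simp [Val.ren, Ren.under, List.lookup_append, lookup_zip_of_not_mem h]

theorem Ren.map_under {ys ys' : List Var} (θ : Ren) (h : ys.Nodup)
    (hl : ys.length = ys'.length) :
    (ys.map Val.var).map (Val.ren (Ren.under ys ys' θ)) = ys'.map Val.var := by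
  apply List.ext_getElem
  · simpa
  · intro i hi hi'
    simp only [List.length_map] at hi hi'
    simpa using Ren.under_getElem θ h hi hi'

theorem Ren.maps_under {ys ys' : List Var} {θ : Ren} (h : ys.Nodup)
    (hl : ys.length = ys'.length) {F : Finset Var}
    (hF : ∀ x ∈ F, x ∉ ys → ∀ y ∈ ys', (Val.var x).ren θ ≠ .var y) :
    Maps (Ren.under ys ys' θ) F ys.toFinset ys'.toFinset := by
  intro x hx
  by_cases hy : x ∈ ys
  · obtain ⟨i, hi, rfl⟩ := List.mem_iff_getElem.1 hy
    rw [Ren.under_getElem θ h hi (hl ▸ hi), mem_varSet]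
    simp
  · rw [Ren.under_of_not_mem ys' θ hy]
    simp only [List.mem_toFinset, hy, iff_false]
    rintro ⟨y, hy', e⟩
    exact hF x hx hy y (by simpa using hy') e.symm

theorem Proc.ren_withNames {ys ys' : List Var} (θ : Ren) (h : ys.Nodup)
    (hl : ys.length = ys'.length) {P : Proc Λ} (hP : ∀ y ∈ ys, y ∉ P.fv) :
    (P.withNames ys).ren (Ren.under ys ys' θ) = (P.ren θ).withNames ys' := by
  rw [withNames, bind, ren_inst, Ren.map_under θ h hl,
    ren_congr (θ' := θ) fun x hx => Ren.under_of_not_mem ys' θ fun hy => hP x hy hx]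
  rfl

/-- The renaming `θ` maps the variables in `F` to values of the same types. -/
def RenTy (Γ Γ' : Env Λ) (F : Finset Var) (θ : Ren) : Prop :=
  ∀ x ∈ F, ∀ σ, Γ x = some σ → HasTy Γ' ((Val.var x).ren θ) σ

theorem RenTy.mono {Γ Γ' : Env Λ} {F F' : Finset Var} {θ} (h : RenTy Γ Γ' F θ) (hF : F' ⊆ F) :
    RenTy Γ Γ' F' θ :=
  fun x hx => h x (hF hx)

theorem RenTy.hasTy {Γ Γ' : Env Λ} {F : Finset Var} {θ} (h : RenTy Γ Γ' F θ) {v : Val} {σ}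
    (hv : HasTy Γ v σ) (hF : v.fv ⊆ F) : HasTy Γ' (v.ren θ) σ := by
  cases hv with
  | var e => exact h _ (hF (by simp [Val.fv])) _ e
  | bool b => exact .bool b

theorem Env.extend_getElem (Γ : Env Λ) {ys : List Var} {σs : List (Ty Λ)} (h : ys.Nodup) {i : ℕ}
    (hi : i < ys.length) (hi' : i < σs.length) : Γ.extend ys σs ys[i] = some σs[i] := by
  simp [extend, lookup_zip_getElem h hi hi']

theorem Env.extend_of_not_mem (Γ : Env Λ) {ys : List Var} (σs : List (Ty Λ)) {x : Var}
    (h : x ∉ ys) : Γ.extend ys σs x = Γ x := by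
  simp [extend, lookup_zip_of_not_mem h]

theorem RenTy.under {Γ Γ' : Env Λ} {P : Proc Λ} {θ} (h : RenTy Γ Γ' P.fv θ) {ys ys' : List Var}
    {σs : List (Ty Λ)} (hy : ys.Nodup) (hy' : ys'.Nodup) (hl : ys.length = ys'.length)
    (hσ : ys.length = σs.length) (hF : ∀ x ∈ P.fv, ∀ y ∈ ys', (Val.var x).ren θ ≠ .var y) :
    RenTy (Γ.extend ys σs) (Γ'.extend ys' σs) (P.withNames ys).fv (Ren.under ys ys' θ) := by
  intro x hx σ hxσ
  by_cases hxy : x ∈ ys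
  · obtain ⟨i, hi, rfl⟩ := List.mem_iff_getElem.1 hxy
    rw [Env.extend_getElem Γ hy hi (hσ ▸ hi)] at hxσ
    rw [Ren.under_getElem θ hy hi (hl ▸ hi)]
    exact .var ((Env.extend_getElem Γ' hy' (hl ▸ hi) (hσ ▸ hi)).trans hxσ)
  · rw [Env.extend_of_not_mem Γ σs hxy] at hxσ
    rw [Ren.under_of_not_mem ys' θ hxy]
    have hP := (Proc.mem_fv_withNames hx).resolve_right hxy
    have := h x hP σ hxσ
    have hne := hF x hP
    generalize (Val.var x).ren θ = v at this hne
    cases this with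
    -- The image of `x` is none of the new bound names, so the extension of `Γ'` does not hide its
    -- type.
    | var e => exact .var ((Env.extend_of_not_mem Γ' σs fun hm => hne _ hm rfl).trans e)
    | bool b => exact .bool b

/-! # Traces and arguments -/

theorem HasTrace.ren {θ : Ren} {x z : Var} (h : (Val.var x).ren θ = .var z) :
    ∀ {s} {A : Beh Λ}, HasTrace x A s → HasTrace z (.ren θ A) s := by
  intro s
  induction s with
  | nil => intros; trivial
  | cons ξ s ih =>
    rintro A ⟨B, w, t⟩
    refine ⟨.ren θ B, (fwd_ren θ).wtr (renLab_tau θ) (fun _ => eq_tau_of_renLab) w ?_, ih t⟩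
    simp only [renLab, Lab.ren, h]
    exact .refl _

theorem traces_mono {x : Var} {A B : Beh Λ} (h : Sub (.proj A {x}) (.proj B {x})) :
    traces x A ⊆ traces x B :=
  fun _ => HasTrace.mono h

/-- Rename `z` back to `x`. The projection moves inside the first renaming, and the composite
renaming is the identity on `x`, the only variable that `A↓_{x}` can have free. -/
theorem traces_ren {θ : Ren} {x z : Var} {A : Beh Λ} (h : (Val.var x).ren θ = .var z)
    (hm : Maps θ A.fv {x} {z}) : traces z (.ren θ A) ⊆ traces x A := by
  intro s hs
  have h₁ : HasTrace x (.ren [(z, .var x)] (.proj (.ren θ A) {z})) s :=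
    HasTrace.ren (by simp [Val.ren]) hs
  refine h₁.mono ((Sub.ren _ (.proj_ren hm)).trans
    ((Sub.ren_ren (θ₂ := []) fun y hy => ?_).trans (.ren_nil _)))
  obtain rfl : y = x := by simpa using (Finset.mem_inter.1 hy).2
  rw [h]
  simp [Val.ren]

theorem Val.ren_atArgs {θ : Ren} {vs : List Val} {i : Var} (h : i < vs.length) :
    ((Val.var i).ren ((List.range vs.length).zip vs)).ren θ =
      (Val.var i).ren ((List.range (vs.map (Val.ren θ)).length).zip (vs.map (Val.ren θ))) := by
  have e : (List.range vs.length)[i]'(by simpa using h) = i := by simp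
  have h₁ := lookup_zip_getElem (List.nodup_range (n := vs.length)) (vs := vs) (i := i)
    (by simpa using h) h
  have h₂ := lookup_zip_getElem (List.nodup_range (n := vs.length)) (vs := vs.map (Val.ren θ))
    (i := i) (by simpa using h) (by simpa using h)
  rw [e] at h₁ h₂
  rw [Val.ren_of_lookup h₁, List.length_map, Val.ren_of_lookup h₂, List.getElem_map]

/-- The behavior in a channel type has only its parameters free, so a further renaming acts on the
arguments alone. -/
theorem Sub.ren_atArgs {A : Beh Λ} {θ : Ren} {vs : List Val}
    (h : A.fv ⊆ Finset.range vs.length) :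
    Sub (.ren θ (A.atArgs vs)) (A.atArgs (vs.map (Val.ren θ))) :=
  .ren_ren fun _ hi => Val.ren_atArgs (Finset.mem_range.1 (h hi))

theorem Sub.atArgs_ren {A : Beh Λ} {θ : Ren} {vs : List Val}
    (h : A.fv ⊆ Finset.range vs.length) :
    Sub (A.atArgs (vs.map (Val.ren θ))) (.ren θ (A.atArgs vs)) :=
  .le_ren_ren fun _ hi => Val.ren_atArgs (Finset.mem_range.1 (h hi))

theorem Beh.not_mem_fv_atArgs {A : Beh Λ} {vs : List Val} {x : Var}
    (h : A.fv ⊆ Finset.range vs.length) (hx : ∀ v ∈ vs, x ∉ v.fv) : x ∉ (A.atArgs vs).fv := by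
  simp only [atArgs, fv, Finset.mem_union, Finset.mem_sdiff, not_or, not_and, not_not]
  constructor
  · intro hA
    rw [Ren.dom, List.map_fst_zip (by simp)]
    simpa using h hA
  · rw [Ren.mem_rangeVars]
    rintro ⟨⟨a, b⟩, hp, hb⟩
    exact hx b (List.of_mem_zip hp).2 hb

/-! # The substitution lemma -/

theorem HasTy.eq_var {Γ : Env Λ} {v : Val} {σ : Ty Λ} (h : HasTy Γ v σ) (hσ : σ ≠ .bool) :
    ∃ x, v = .var x := by
  cases h with
  | var => exact ⟨_, rfl⟩
  | bool => exact absurd rfl hσ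

/-- Fresh names for the variables `ys` bound in `P`, which is typed by `A`. -/
theorem exists_fresh_binder (θ : Ren) (P : Proc Λ) (A : Beh Λ) (n : ℕ) :
    ∃ ys : List Var, ys.length = n ∧ ys.Nodup ∧ (∀ y ∈ ys, y ∉ (P.ren θ).fv) ∧
      (∀ x ∈ P.fv, ∀ y ∈ ys, (Val.var x).ren θ ≠ .var y) ∧
      ∀ x ∈ A.fv, ∀ y ∈ ys, (Val.var x).ren θ ≠ .var y := by
  obtain ⟨ys, h₁, h₂, h₃⟩ := exists_fresh n
    ((P.ren θ).fv ∪ (P.fv ∪ A.fv).biUnion fun x => ((Val.var x).ren θ).fv)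
  have key : ∀ x ∈ P.fv ∪ A.fv, ∀ y ∈ ys, (Val.var x).ren θ ≠ .var y := by
    intro x hx y hy e
    refine h₃ y hy (Finset.mem_union_right _ (Finset.mem_biUnion.2 ⟨x, hx, ?_⟩))
    simp [e, Val.fv]
  exact ⟨ys, h₁, h₂, fun y hy h => h₃ y hy (Finset.mem_union_left _ h),
    fun x hx => key x (Finset.mem_union_left _ hx), fun x hx => key x (Finset.mem_union_right _ hx)⟩

/-- The renaming need not be injective and may produce booleans, but a subject of channel or
resource type still becomes a variable. At a binder, the new names avoid the images of the free
variables of both the body and its type, so hiding selects the same actions before and after.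
Subsumption then moves the renaming outside the type constructor. -/
theorem Typed.ren {Γ : Env Λ} {P A} (h : Typed Γ P A) :
    ∀ {Γ' θ}, RenTy Γ Γ' P.fv θ → Typed Γ' (P.ren θ) (.ren θ A) := by
  induction h with
  | zero => intro Γ' θ _; exact .sub .zero (.nil _)
  | @out Γ x n σ A₁ hA₁ vs P A₂ _ hx hvs ih =>
    intro Γ' θ hθ
    simp only [Proc.fv] at hθ
    have hxθ := hθ.hasTy hx (fun z hz => by simp_all [Occ.fv])
    obtain ⟨z, hz⟩ := hxθ.eq_var (by simp)
    have hl : vs.length = n := by simpa using hvs.length_eq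
    have hvs' : List.Forall₂ (HasTy Γ') (vs.map (Val.ren θ)) (List.ofFn σ) := by
      rw [List.forall₂_map_left_iff]
      have := List.forall₂_iff_get.1 hvs
      refine List.forall₂_iff_get.2 ⟨this.1, fun i h₁ h₂ => hθ.hasTy (this.2 i h₁ h₂) ?_⟩
      intro w hw
      refine Finset.mem_union_left _ (Finset.mem_union_right _ (Occ.mem_foldr_fv.2 ?_))
      exact ⟨_, List.mem_map_of_mem (List.get_mem vs ⟨i, h₁⟩), hw⟩
    rw [hz] at hxθ
    have := Typed.out (ih (hθ.mono (Finset.subset_union_right))) hxθ hvs'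
    simp only [Proc.ren, Occ.ren, hz, List.map_map] at this ⊢
    exact this.sub ((Sub.out z ((Sub.par (.atArgs_ren (by rwa [hl])) (.refl _)).trans
      (.ren_par θ _ _))).trans (.ren_out _ hz))
  | @inp Γ x n σ A₁ hA₁ ys P A₂ hl hnd hys _ hx hs ih =>
    intro Γ' θ hθ
    simp only [Proc.fv] at hθ
    have hxθ := hθ.hasTy hx (fun z hz => by simp_all [Occ.fv])
    obtain ⟨z, hz⟩ := hxθ.eq_var (by simp)
    obtain ⟨ys', hl', hnd', hys', hP, hA⟩ := exists_fresh_binder θ P A₂ n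
    have hll : ys.length = ys'.length := hl.trans hl'.symm
    have := ih ((hθ.mono Finset.subset_union_right).under hnd hnd' hll (by simpa using hl) hP)
    rw [Proc.ren_withNames θ hnd hll hys] at this
    have hm : Maps (Ren.under ys ys' θ) A₂.fv ys.toFinset ys'.toFinset :=
      Ren.maps_under hnd hll fun x hx _ => hA x hx
    rw [hz] at hxθ
    -- With `θ'` the renaming under the binder: `(θ'A₂)↓_{ys'} ≤ θ'(A₂↓_{ys}) ≤ θ'(A₁(ys)) ≤
    -- A₁(ys')`.
    have := Typed.inp hl' hnd' hys' this hxθ ((Sub.proj_ren hm).trans ((Sub.ren _ hs).trans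
      (by
        have := Sub.ren_atArgs (A := A₁) (θ := Ren.under ys ys' θ) (vs := ys.map Val.var)
          (by simpa [hl] using hA₁)
        rwa [Ren.map_under θ hnd hll] at this)))
    simp only [Proc.ren, Occ.ren, hz]
    refine this.sub ((Sub.inp z (.excl_ren hm fun x _ hx => ?_)).trans (.ren_inp _ hz))
    exact Ren.under_of_not_mem ys' θ (by simpa using hx)
  | par _ _ ih ih' =>
    intro Γ' θ hθ
    exact .sub (.par (ih (hθ.mono Finset.subset_union_left))
      (ih' (hθ.mono Finset.subset_union_right))) (.ren_par θ _ _)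
  | rep _ ih =>
    intro Γ' θ hθ
    exact .sub (.rep (ih hθ)) (.ren_rep θ _)
  | ite hv _ _ ih ih' =>
    intro Γ' θ hθ
    simp only [Proc.fv] at hθ
    exact .ite (hθ.hasTy hv fun z hz => by simp_all [Occ.fv])
      (ih (hθ.mono fun z hz => by simp [hz])) (ih' (hθ.mono fun z hz => by simp [hz]))
  | @new Γ x n σ A₁ hA₁ P A hx _ ih =>
    intro Γ' θ hθ
    obtain ⟨ys', hl', hnd', hys', hP, hA⟩ := exists_fresh_binder θ P A 1
    obtain ⟨x', rfl⟩ := List.length_eq_one_iff.1 hl'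
    have := ih (RenTy.under (P := P) (ys := [x]) (σs := [_]) hθ (by simp) hnd' rfl rfl hP)
    rw [Proc.ren_withNames θ (by simp) (by simp) (by simpa using hx)] at this
    have hm : Maps (Ren.under [x] [x'] θ) A.fv {x} {x'} := by
      simpa using Ren.maps_under (ys := [x]) (ys' := [x']) (by simp) (by simp)
        fun y hy _ => hA y hy
    exact .sub (.new (by simpa using hys') this) (.nu_ren hm fun y _ hy =>
      Ren.under_of_not_mem [x'] θ (by simpa using hy))
  | @acc Γ ξ x P A _ hx ih =>
    intro Γ' θ hθ
    simp only [Proc.fv] at hθ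
    have hxθ := hθ.hasTy hx (fun z hz => by simp_all [Occ.fv])
    obtain ⟨z, hz⟩ := hxθ.eq_var (by simp)
    rw [hz] at hxθ
    simp only [Proc.ren, Occ.ren, hz]
    exact .sub (.acc (ih (hθ.mono Finset.subset_union_right)) hxθ) (.ren_acc ξ A hz)
  | @newR Γ x Φ P A hx _ ht ih =>
    intro Γ' θ hθ
    obtain ⟨ys', hl', hnd', hys', hP, hA⟩ := exists_fresh_binder θ P A 1
    obtain ⟨x', rfl⟩ := List.length_eq_one_iff.1 hl'
    have := ih (RenTy.under (P := P) (ys := [x]) (σs := [_]) hθ (by simp) hnd' rfl rfl hP)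
    rw [Proc.ren_withNames θ (by simp) (by simp) (by simpa using hx)] at this
    have hm : Maps (Ren.under [x] [x'] θ) A.fv {x} {x'} := by
      simpa using Ren.maps_under (ys := [x]) (ys' := [x']) (by simp) (by simp)
        fun y hy _ => hA y hy
    have hx' : (Val.var x).ren (Ren.under [x] [x'] θ) = .var x' :=
      Ren.under_getElem (ys := [x]) (ys' := [x']) θ (by simp) (i := 0) (by simp) (by simp)
    exact .sub (.newR (by simpa using hys') this ((traces_ren hx' hm).trans ht))
      (.excl_ren hm fun y _ hy => Ren.under_of_not_mem [x'] θ (by simpa using hy))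
  | sub _ s ih =>
    intro Γ' θ hθ
    exact (ih hθ).sub (s.ren θ)

/-- This is the substitution lemma for the empty renaming, which constrains the environments only on
the free variables of `P`. -/
theorem Typed.weaken {Γ Γ' : Env Λ} {P A} (h : Typed Γ P A) (hΓ : ∀ x ∈ P.fv, Γ' x = Γ x) :
    Typed Γ' P A := by
  have : Typed Γ' (P.ren []) (.ren [] A) := h.ren fun x hx σ hσ => by
    rw [Val.ren_nil]
    exact .var ((hΓ x hx).trans hσ)
  rw [Proc.ren_nil] at this
  exact this.sub (.ren_nil A)

/-! # Strengthening -/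

/-- Actions on a variable that is not free in the process can be removed from its type. -/
theorem Typed.nu {Γ : Env Λ} {P A} (h : Typed Γ P A) {x : Var} (hx : x ∉ P.fv) :
    Typed Γ P (.nu x A) := by
  induction h with
  | zero => exact .sub .zero (.nil _)
  | @out Γ z n σ A₁ hA₁ vs P A₂ _ hz hvs ih =>
    simp only [Proc.fv, Finset.mem_union, not_or, Occ.mem_foldr_fv] at hx
    have hl : vs.length = n := by simpa using hvs.length_eq
    have hzx : z ≠ x := by
      rintro rfl
      exact hx.1.1 (by simp [Occ.fv, Val.fv])
    refine (Typed.out (ih hx.2) hz hvs).sub ((Sub.out z ?_).trans (.nu_out _ hzx))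
    -- The part contributed by the channel type has only the arguments free, and `x` is not among
    -- them.
    refine (Sub.par (.le_nu (Beh.not_mem_fv_atArgs (by rwa [hl]) ?_)) (.refl _)).trans
      (.nu_par x _ _)
    exact fun v hv hxv => hx.1.2 ⟨_, List.mem_map_of_mem hv, hxv⟩
  | @inp Γ z n σ A₁ hA₁ ys P A₂ hl hnd hys ht hz hs ih =>
    simp only [Proc.fv, Finset.mem_union, not_or] at hx
    have hzx : z ≠ x := by
      rintro rfl
      exact hx.1 (by simp [Occ.fv, Val.fv])
    by_cases hxy : x ∈ ys
    · refine (Typed.inp hl hnd hys ht hz hs).sub ((Sub.inp z (.le_nu ?_)).trans (.nu_inp _ hzx))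
      simp [Beh.fv, hxy]
    -- Restricting the body's type only decreases its projection, so the bound by the channel type
    -- survives.
    · have := ih fun h => (Proc.mem_fv_withNames h).elim hx.2 hxy
      exact (Typed.inp hl hnd hys this hz ((Sub.proj _ (.nu_le x A₂)).trans hs)).sub
        ((Sub.inp z (.excl_nu x _ _)).trans (.nu_inp _ hzx))
  | par _ _ ih ih' =>
    simp only [Proc.fv, Finset.mem_union, not_or] at hx
    exact (Typed.par (ih hx.1) (ih' hx.2)).sub (.nu_par x _ _)
  | rep _ ih => exact (Typed.rep (ih hx)).sub (.nu_rep x _)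
  | ite hv _ _ ih ih' =>
    simp only [Proc.fv, Finset.mem_union, not_or] at hx
    exact .ite hv (ih hx.1.2) (ih' hx.2)
  | @new Γ y n σ A₁ hA₁ P A hy ht ih =>
    by_cases hxy : x = y
    · subst hxy
      exact (Typed.new hy ht).sub (.le_nu (by simp [Beh.fv]))
    · exact (Typed.new hy (ih (Proc.not_mem_fv_withNames hx hxy))).sub (.nu_nu _ _ _)
  | @acc Γ ξ z P A _ hz ih =>
    simp only [Proc.fv, Finset.mem_union, not_or] at hx
    have hzx : z ≠ x := by
      rintro rfl
      exact hx.1 (by simp [Occ.fv, Val.fv])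
    exact (Typed.acc (ih hx.2) hz).sub (.nu_acc ξ A hzx)
  | @newR Γ y Φ P A hy ht hΦ ih =>
    by_cases hxy : x = y
    · subst hxy
      exact (Typed.newR hy ht hΦ).sub (.le_nu (by simp [Beh.fv]))
    · exact (Typed.newR hy (ih (Proc.not_mem_fv_withNames hx hxy))
        ((traces_mono (.proj _ (.nu_le x A))).trans hΦ)).sub (.excl_nu x _ A)
  | sub _ s ih => exact (ih hx).sub (s.nu x)

/-! # Inversion of the type judgment -/

/-- A derivation ends with the rule for the process constructor followed by subsumptions, which
compose into a single inequality. The same applies to the other inversions. -/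
theorem Typed.par_inv {Γ : Env Λ} {P Q T} (h : Typed Γ (.par P Q) T) :
    ∃ A B, Typed Γ P A ∧ Typed Γ Q B ∧ Sub (.par A B) T := by
  generalize e : Proc.par P Q = R at h
  induction h with
  | par h h' => cases e; exact ⟨_, _, h, h', .refl _⟩
  | sub _ s ih =>
    obtain ⟨A, B, h, h', s'⟩ := ih e
    exact ⟨A, B, h, h', s'.trans s⟩
  | _ => cases e

theorem Typed.rep_inv {Γ : Env Λ} {P T} (h : Typed Γ (.rep P) T) :
    ∃ A, Typed Γ P A ∧ Sub (.rep A) T := by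
  generalize e : Proc.rep P = R at h
  induction h with
  | rep h => cases e; exact ⟨_, h, .refl _⟩
  | sub _ s ih =>
    obtain ⟨A, h, s'⟩ := ih e
    exact ⟨A, h, s'.trans s⟩
  | _ => cases e

theorem Typed.ite_inv {Γ : Env Λ} {v P Q T} (h : Typed Γ (.ite v P Q) T) :
    Typed Γ P T ∧ Typed Γ Q T := by
  generalize e : Proc.ite v P Q = R at h
  induction h with
  | ite _ h h' => cases e; exact ⟨h, h'⟩
  | sub _ s ih => exact ⟨(ih e).1.sub s, (ih e).2.sub s⟩
  | _ => cases e

theorem Typed.acc_inv {Γ : Env Λ} {ξ x P T} (h : Typed Γ (.acc ξ (.var x) P) T) :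
    ∃ A, Typed Γ P A ∧ Sub (.acc ξ x A) T := by
  generalize e : Proc.acc ξ (.var x) P = R at h
  induction h with
  | acc h => cases e; exact ⟨_, h, .refl _⟩
  | sub _ s ih =>
    obtain ⟨A, h, s'⟩ := ih e
    exact ⟨A, h, s'.trans s⟩
  | _ => cases e

theorem Typed.out_inv {Γ : Env Λ} {x ws P T} (h : Typed Γ (.out (.var x) ws P) T) :
    ∃ n σ A₁ hA₁ vs A₂, ws = vs.map Occ.val ∧ Typed Γ P A₂ ∧
      HasTy Γ (.var x) (.chan n σ A₁ hA₁) ∧ List.Forall₂ (HasTy Γ) vs (List.ofFn σ) ∧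
      Sub (.out x (.par (A₁.atArgs vs) A₂)) T := by
  generalize e : Proc.out (.var x) ws P = R at h
  induction h with
  | out h h₁ h₂ => cases e; exact ⟨_, _, _, _, _, _, rfl, h, h₁, h₂, .refl _⟩
  | sub _ s ih =>
    obtain ⟨n, σ, A₁, hA₁, vs, A₂, e, h, h₁, h₂, s'⟩ := ih e
    exact ⟨n, σ, A₁, hA₁, vs, A₂, e, h, h₁, h₂, s'.trans s⟩
  | _ => cases e

theorem Typed.inp_inv {Γ : Env Λ} {x n P T} (h : Typed Γ (.inp (.var x) n P) T) :
    ∃ σ A₁ hA₁ ys A₂, ys.length = n ∧ ys.Nodup ∧ (∀ y ∈ ys, y ∉ P.fv) ∧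
      Typed (Γ.extend ys (List.ofFn σ)) (P.withNames ys) A₂ ∧
      HasTy Γ (.var x) (.chan n σ A₁ hA₁) ∧
      Sub (.proj A₂ ys.toFinset) (A₁.atArgs (ys.map Val.var)) ∧
      Sub (.inp x (.excl A₂ ys.toFinset)) T := by
  generalize e : Proc.inp (.var x) n P = R at h
  induction h with
  | inp h₁ h₂ h₃ h₄ h₅ h₆ => cases e; exact ⟨_, _, _, _, _, h₁, h₂, h₃, h₄, h₅, h₆, .refl _⟩
  | sub _ s ih =>
    obtain ⟨σ, A₁, hA₁, ys, A₂, h₁, h₂, h₃, h₄, h₅, h₆, s'⟩ := ih e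
    exact ⟨σ, A₁, hA₁, ys, A₂, h₁, h₂, h₃, h₄, h₅, h₆, s'.trans s⟩
  | _ => cases e

/-- A typed body of a binder can be typed with any other name for the bound variable. -/
theorem Typed.rename {Γ : Env Λ} {P : Proc Λ} {A} {x y : Var} {σ : Ty Λ} (hx : x ∉ P.fv) (hy : y ∉ P.fv)
    (hxy : x ≠ y) (h : Typed (Γ.extend [y] [σ]) (P.withNames [y]) A) :
    Typed (Γ.extend [x] [σ]) (P.withNames [x]) (.ren (Ren.under [y] [x] []) (.nu x A)) := by
  have hΓ : RenTy Γ Γ P.fv [] := fun z _ τ hτ => by rw [Val.ren_nil]; exact .var hτ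
  have := (h.nu (Proc.not_mem_fv_withNames hx hxy)).ren (RenTy.under (P := P) (ys := [y])
    (ys' := [x]) (σs := [σ]) hΓ (by simp) (by simp) rfl rfl (by
      intro z hz w hw
      rw [Val.ren_nil]
      obtain rfl : w = x := by simpa using hw
      rintro ⟨⟩
      exact hx hz))
  rwa [Proc.ren_withNames [] (by simp) (by simp) (by simpa using hy), Proc.ren_nil] at this

/-- The type `A` may mention `x`, so renaming `y` to `x` could merge two variables. Restricting `x`
first rules this out. -/
theorem maps_under_single {x y : Var} (A : Beh Λ) :
    Maps (Ren.under [y] [x] []) (Beh.nu x A).fv {y} {x} := by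
  have := Ren.maps_under (ys := [y]) (ys' := [x]) (θ := []) (by simp) rfl
    (F := (Beh.nu x A).fv) (by
      intro z hz _ w hw
      rw [Val.ren_nil]
      obtain rfl : w = x := by simpa using hw
      rintro ⟨⟩
      simp [Beh.fv] at hz)
  simpa using this

theorem Ren.under_single_of_ne {x y z : Var} (h : z ∉ ({y} : Finset Var)) :
    (Val.var z).ren (Ren.under [y] [x] []) = (Val.var z).ren [] :=
  Ren.under_of_not_mem _ _ (by simpa using h)

theorem Typed.nu_inv {Γ : Env Λ} {P T} (h : Typed Γ (.nu P) T) {x : Var} (hx : x ∉ P.fv) :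
    ∃ n σ A₁ hA₁ A, Typed (Γ.extend [x] [.chan n σ A₁ hA₁]) (P.withNames [x]) A ∧
      Sub (.nu x A) T := by
  generalize e : Proc.nu P = R at h
  induction h with
  | @new Γ y n σ A₁ hA₁ _ A hy h =>
    cases e
    by_cases hxy : x = y
    · subst hxy
      exact ⟨n, σ, A₁, hA₁, A, h, .refl _⟩
    · refine ⟨n, σ, A₁, hA₁, _, h.rename hx hy hxy, ?_⟩
      -- `(νx)⟨x/y⟩(νx)A ≤ (νy)(νx)A ≤ (νy)A`.
      exact (Sub.nu_ren (maps_under_single A) fun _ _ => Ren.under_single_of_ne).trans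
        ((Sub.ren_nil _).trans (.nu y (.nu_le x A)))
  | sub _ s ih =>
    obtain ⟨n, σ, A₁, hA₁, A, h, s'⟩ := ih e
    exact ⟨n, σ, A₁, hA₁, A, h, s'.trans s⟩
  | _ => cases e

theorem Typed.nuR_inv {Γ : Env Λ} {Φ P T} (h : Typed Γ (.nuR Φ P) T) {x : Var} (hx : x ∉ P.fv) :
    ∃ A, Typed (Γ.extend [x] [.res]) (P.withNames [x]) A ∧ traces x A ⊆ Φ.carrier ∧
      Sub (.excl A {x}) T := by
  generalize e : Proc.nuR Φ P = R at h
  induction h with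
  | @newR Γ y _ _ A hy h hΦ =>
    cases e
    by_cases hxy : x = y
    · subst hxy
      exact ⟨A, h, hΦ, .refl _⟩
    · refine ⟨_, h.rename hx hy hxy, ?_, ?_⟩
      · refine (traces_ren ?_ (maps_under_single A)).trans
          ((traces_mono (.proj _ (.nu_le x A))).trans hΦ)
        exact Ren.under_getElem (ys := [y]) (ys' := [x]) [] (by simp) (i := 0) (by simp) (by simp)
      · exact (Sub.excl_ren (maps_under_single A) fun _ _ => Ren.under_single_of_ne).trans
          ((Sub.ren_nil _).trans (.excl _ (.nu_le x A)))
  | sub _ s ih =>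
    obtain ⟨A, h, hΦ, s'⟩ := ih e
    exact ⟨A, h, hΦ, s'.trans s⟩
  | _ => cases e

/-! # Subject reduction -/

theorem Typed.extend_of_not_mem {Γ : Env Λ} {Q B} (h : Typed Γ Q B) {x : Var} (hx : x ∉ Q.fv)
    (σ : Ty Λ) : Typed (Γ.extend [x] [σ]) Q (.nu x B) :=
  (h.nu hx).weaken fun z hz => Env.extend_of_not_mem Γ _ (by
    simp only [List.mem_singleton]
    rintro rfl
    exact hx hz)

theorem Proc.withNames_par {P Q : Proc Λ} (h : Q.LC) (x : Var) :
    (P.par Q).withNames [x] = (P.withNames [x]).par Q :=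
  congrArg _ (h.withNames [x])

/-- Each structural law `P ⪯ Q` corresponds to an inequality from the type built for `Q` to that of
`P`; laws used in one direction only need it in one direction. -/
theorem SP.typed {P Q : Proc Λ} (h : SP P Q) : ∀ {Γ T}, Typed Γ P T → Typed Γ Q T := by
  induction h with
  | refl => exact id
  | trans _ _ ih ih' => exact fun h => ih' (ih h)
  | zero P =>
    intro Γ T h
    obtain ⟨A, B, h, -, s⟩ := h.par_inv
    exact h.sub ((Sub.le_par A B).trans s)
  | zero' P => exact fun h => (h.par .zero).sub (.par_nil _)
  | commut P Q =>
    intro Γ T h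
    obtain ⟨A, B, h, h', s⟩ := h.par_inv
    exact (h'.par h).sub ((Sub.par_comm B A).trans s)
  | assoc P Q R =>
    intro Γ T h
    obtain ⟨A, D, hA, h, s⟩ := h.par_inv
    obtain ⟨B, C, hB, hC, s'⟩ := h.par_inv
    exact ((hA.par hB).par hC).sub ((Sub.par_assoc' A B C).trans ((Sub.par (.refl A) s').trans s))
  | assoc' P Q R =>
    intro Γ T h
    obtain ⟨D, C, h, hC, s⟩ := h.par_inv
    obtain ⟨A, B, hA, hB, s'⟩ := h.par_inv
    exact (hA.par (hB.par hC)).sub ((Sub.par_assoc A B C).trans ((Sub.par s' (.refl C)).trans s))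
  | rep P =>
    intro Γ T h
    obtain ⟨A, h, s⟩ := h.rep_inv
    exact (h.rep.par h).sub ((Sub.par_comm _ A).trans ((Sub.par_rep A).trans s))
  | new P Q hQ =>
    intro Γ T h
    obtain ⟨D, B, h, hB, s⟩ := h.par_inv
    obtain ⟨x, hx⟩ := Infinite.exists_notMem_finset (P.fv ∪ Q.fv)
    simp only [Finset.mem_union, not_or] at hx
    obtain ⟨n, σ, A₁, hA₁, A, hA, s'⟩ := h.nu_inv hx.1
    -- The type `B` of `Q` may mention `x` through subsumption, so `Q` enters the scope with type
    -- `(νx)B`.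
    have := hA.par (hB.extend_of_not_mem hx.2 _)
    rw [← Proc.withNames_par hQ] at this
    exact (Typed.new (by simp [Proc.fv, hx]) this).sub ((Sub.nu_par_extrude x A B).trans
      ((Sub.par s' (.nu_le x B)).trans s))
  | newR Φ P Q hQ =>
    intro Γ T h
    obtain ⟨D, B, h, hB, s⟩ := h.par_inv
    obtain ⟨x, hx⟩ := Infinite.exists_notMem_finset (P.fv ∪ Q.fv)
    simp only [Finset.mem_union, not_or] at hx
    obtain ⟨A, hA, hΦ, s'⟩ := h.nuR_inv hx.1
    have := hA.par (hB.extend_of_not_mem hx.2 _)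
    rw [← Proc.withNames_par hQ] at this
    exact (Typed.newR (by simp [Proc.fv, hx]) this
      ((traces_mono (.proj_par_extrude x A B)).trans hΦ)).sub ((Sub.excl_par_extrude x A B).trans
      ((Sub.par s' (.nu_le x B)).trans s))
  | par _ _ ih ih' =>
    intro Γ T h
    obtain ⟨A, B, h, h', s⟩ := h.par_inv
    exact ((ih h).par (ih' h')).sub s
  | cNew x hP hQ _ ih =>
    intro Γ T h
    obtain ⟨n, σ, A₁, hA₁, A, h, s⟩ := h.nu_inv hP
    exact (Typed.new hQ (ih h)).sub s
  | cNewR Φ x hP hQ _ ih =>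
    intro Γ T h
    obtain ⟨A, h, hΦ, s⟩ := h.nuR_inv hP
    exact (Typed.newR hQ (ih h) hΦ).sub s

/-- The substitution lemma for the variables bound by an input. -/
theorem Typed.bind {Γ : Env Λ} {ys : List Var} {σs : List (Ty Λ)} {P : Proc Λ} {A}
    {vs : List Val}
    (h : Typed (Γ.extend ys σs) (P.withNames ys) A) (hnd : ys.Nodup) (hys : ∀ y ∈ ys, y ∉ P.fv)
    (hl : ys.length = vs.length) (hvs : List.Forall₂ (HasTy Γ) vs σs) :
    Typed Γ (P.bind vs) (.ren (ys.zip vs) A) := by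
  have hy {i : ℕ} (hi : i < ys.length) : (Val.var ys[i]).ren (ys.zip vs) = vs[i] :=
    Val.ren_of_lookup (lookup_zip_getElem hnd hi (hl ▸ hi))
  have hn {x : Var} (hx : x ∉ ys) : (Val.var x).ren (ys.zip vs) = .var x :=
    Val.ren_of_lookup_none (lookup_zip_of_not_mem hx vs)
  have hm : (ys.map Val.var).map (Val.ren (ys.zip vs)) = vs := by
    apply List.ext_getElem
    · simpa
    · intro i hi hi'
      simpa using hy (i := i) (by simpa using hi)
  have e : (P.withNames ys).ren (ys.zip vs) = P.bind vs := by
    rw [Proc.withNames, Proc.bind, Proc.ren_inst, hm,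
      Proc.ren_id fun x hx => hn fun hxy => hys x hxy hx, Proc.bind]
  rw [← e]
  refine h.ren fun x _ σ hσ => ?_
  by_cases hxy : x ∈ ys
  · obtain ⟨i, hi, rfl⟩ := List.mem_iff_getElem.1 hxy
    have hls := hvs.length_eq
    rw [Env.extend_getElem Γ hnd hi (hls ▸ hl ▸ hi)] at hσ
    cases hσ
    rw [hy hi]
    exact (List.forall₂_iff_get.1 hvs).2 i (hl ▸ hi) (hls ▸ hl ▸ hi)
  · rw [Env.extend_of_not_mem Γ σs hxy] at hσ
    rw [hn hxy]
    exact .var hσ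

/-- The transition label of a reduction. -/
def RLab.lab : RLab Λ → Lab Λ
  | .acc x ξ => .acc (.var x) ξ
  | .tau => .tau

theorem RLab.disjoint_lab {L : RLab Λ} {x : Var} (h : x ∉ L.target) :
    Disjoint L.lab.target (varSet {x}) := by
  cases L with
  | acc y ξ =>
    refine disjoint_varSet_singleton.2 ?_
    rintro ⟨⟩
    exact h rfl
  | tau => exact (nuLab_tau (Λ := Λ) x).2

/-- The types `x̄.(A₁(vs) | A)` and `x.(A₂↑_{ys})` synchronize and release `A₁(vs)` and `A₂↑_{ys}`,
which together bound the type `⟨vs/ys⟩A₂` of the instantiated receiver. -/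
theorem Red.com_typed {Γ : Env Λ} {x : Var} {vs : List Val} {P Q : Proc Λ} {T}
    (h : Typed Γ (.par (.out (.var x) (vs.map Occ.val) P) (.inp (.var x) vs.length Q)) T) :
    ∃ T', WTr T .tau T' ∧ Typed Γ (.par P (Q.bind vs)) T' := by
  obtain ⟨D, E, h₁, h₂, s⟩ := h.par_inv
  obtain ⟨n, σ, A₁, hA₁, vs', A, e, hP, hx, hvs, s₁⟩ := h₁.out_inv
  obtain rfl : vs = vs' := by
    refine List.map_injective_iff.2 ?_ e
    intro a b hab
    cases hab
    rfl
  obtain ⟨σ', A₁', hA₁', ys, A₂, hl, hnd, hys, hQ, hx', hs, s₂⟩ := h₂.inp_inv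
  cases hx with | var hx =>
  cases hx' with | var hx' =>
  cases hx.symm.trans hx'
  -- `⟨vs/ys⟩A₂ ≤ ⟨vs/ys⟩(A₂↓_{ys}) | ⟨vs/ys⟩(A₂↑_{ys}) ≤ A₁(vs) | A₂↑_{ys}`: the typing condition
  -- on the input bounds the first factor, and the second has none of the `ys` free.
  have key : Sub (.ren (ys.zip vs) A₂) (.par (A₁.atArgs vs) (.excl A₂ ys.toFinset)) := by
    refine (Sub.ren _ (.le_proj_par_excl A₂ ys.toFinset)).trans ((Sub.par_ren _ _ _).trans
      (Sub.par ((Sub.ren _ hs).trans ?_) (.ren_id fun z hz => ?_)))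
    · have := Sub.ren_atArgs (A := A₁) (θ := ys.zip vs) (vs := ys.map Val.var)
        (by simpa [hl] using hA₁)
      have hm : (ys.map Val.var).map (Val.ren (ys.zip vs)) = vs := by
        apply List.ext_getElem
        · simpa
        · intro i hi hi'
          simp only [List.length_map] at hi
          simpa using Val.ren_of_lookup (lookup_zip_getElem hnd hi hi')
      rwa [hm] at this
    · refine Val.ren_of_lookup_none (lookup_zip_of_not_mem ?_ vs)
      simpa [Beh.fv] using (Finset.mem_sdiff.1 hz).2
  have t : Tr (.par (.out x (.par (A₁.atArgs vs) A)) (.inp x (.excl A₂ ys.toFinset))) .tau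
      (.par (.par (A₁.atArgs vs) A) (.excl A₂ ys.toFinset)) :=
    .com (.par2R (.out x _) (.inp x _))
  obtain ⟨T', w, s'⟩ := ((Sub.par s₁ s₂).trans s).step t
  refine ⟨T', w, (hP.par (hQ.bind hnd hys hl hvs)).sub ((Sub.par (.refl A) key).trans ?_)⟩
  exact (Sub.par_assoc _ _ _).trans ((Sub.par (.par_comm _ _) (.refl _)).trans s')

/-- Subject reduction: the type of a process simulates its reductions, and safety is
preserved. -/
theorem Red.typed {P P' : Proc Λ} {L} (h : Red P L P') : ∀ {Γ T}, Typed Γ P T →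
    (∃ T', WTr T L.lab T' ∧ Typed Γ P' T') ∧ (P.Safe → P'.Safe) := by
  have lift {T T' : Beh Λ} {Γ P A l} (s : Sub T T') (w : WTr T l A) (h : Typed Γ P A) :
      ∃ T₁, WTr T' l T₁ ∧ Typed Γ P T₁ := by
    obtain ⟨T₁, w', s'⟩ := s.wtr w
    exact ⟨T₁, w', h.sub s'⟩
  induction h with
  | com x vs P Q =>
    intro Γ T h
    refine ⟨Red.com_typed h, ?_⟩
    simp only [Proc.Safe, Proc.bind, Proc.safe_inst]
    exact id
  | acc ξ x P =>
    intro Γ T h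
    obtain ⟨A, h, s⟩ := h.acc_inv
    exact ⟨lift s (.of_tr (.acc ξ x A)) h, id⟩
  | par Q _ ih =>
    intro Γ T h
    obtain ⟨A, B, h, h', s⟩ := h.par_inv
    obtain ⟨⟨A', w, h⟩, hs⟩ := ih h
    exact ⟨lift s (w.parL B) (h.par h'), fun h => ⟨hs h.1, h.2⟩⟩
  | new x hP hQ hL _ ih =>
    intro Γ T h
    obtain ⟨n, σ, A₁, hA₁, A, h, s⟩ := h.nu_inv hP
    obtain ⟨⟨A', w, h⟩, hs⟩ := ih h
    simp only [Proc.safe_withNames] at hs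
    exact ⟨lift s ((fwd_nu x).wtr (nuLab_tau x) (fun _ h => h.1) w
      ⟨rfl, RLab.disjoint_lab hL⟩) (.new hQ h), hs⟩
  | newR1 Φ x ξ hP hQ _ ih =>
    intro Γ T h
    obtain ⟨A, h, hΦ, s⟩ := h.nuR_inv hP
    obtain ⟨⟨A', w, h⟩, hs⟩ := ih h
    simp only [Proc.safe_withNames] at hs
    have hx : (RLab.acc x ξ).lab.target ⊆ varSet {x} := by
      simp [RLab.lab, Lab.target, varSet]
    have wp : WTr (A.proj {x}) (.acc (.var x) ξ) (A'.proj {x}) :=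
      (fwd_proj {x}).wtr (projLab_tau _) (fun _ h => h.elim And.left And.left) w
        (Or.inr ⟨rfl, hx⟩)
    refine ⟨lift s ((fwd_excl {x}).wtr (exclLab_tau _) (fun _ h => h.elim And.left And.left) w
      (Or.inr ⟨rfl, hx⟩)) (.newR hQ h fun t ht => ?_), fun h => ⟨?_, hs h.2⟩⟩
    · exact hΦ ⟨_, wp, ht⟩
    -- The one-letter sequence `ξ` is a trace of the body's type, so it belongs to `Φ` and the
    -- residual is not empty.
    · rw [Ne, TraceSet.residual_empty_iff, not_not]
      exact hΦ ⟨_, wp, trivial⟩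
  | newR2 Φ x hP hQ hL _ ih =>
    intro Γ T h
    obtain ⟨A, h, hΦ, s⟩ := h.nuR_inv hP
    obtain ⟨⟨A', w, h⟩, hs⟩ := ih h
    simp only [Proc.safe_withNames] at hs
    have hd := RLab.disjoint_lab hL
    have wp : WTr (A.proj {x}) .tau (A'.proj {x}) :=
      (fwd_proj {x}).wtr (projLab_tau _) (fun _ h => h.elim And.left And.left) w
        (Or.inl ⟨rfl, hd⟩)
    refine ⟨lift s ((fwd_excl {x}).wtr (exclLab_tau _) (fun _ h => h.elim And.left And.left) w
      (Or.inl ⟨rfl, hd⟩)) (.newR hQ h ?_), fun h => ⟨h.1, hs h.2⟩⟩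
    -- Seen through the projection on `x` the step is silent, so no trace is gained.
    exact (traces_mono (.of_taus wp.taus)).trans hΦ
  -- Both branches have the type of the conditional, which answers by staying put.
  | ifT P Q => exact fun h => ⟨⟨_, Taus.wtr .refl, h.ite_inv.1⟩, And.left⟩
  | ifF P Q => exact fun h => ⟨⟨_, Taus.wtr .refl, h.ite_inv.2⟩, And.right⟩
  | sp p _ q ih =>
    intro Γ T h
    obtain ⟨⟨T', w, h'⟩, hs⟩ := ih (p.typed h)
    exact ⟨⟨T', w, q.typed h'⟩, fun h => q.safe (hs (p.safe h))⟩

end ResPi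

/-! ### Safety along a sequence of reductions -/

theorem mainTheorem1 {Λ : Type*} (Γ : ResPi.Env Λ) (P : ResPi.Proc Λ) (A : ResPi.Beh Λ)
    (hsafe : P.Safe) (htyped : ResPi.Typed Γ P A)
    (P' : ResPi.Proc Λ) (hred : ResPi.Steps P P') :
    P'.Safe := by
  -- Safety alone is not inductive: the next step also needs the reduct to be typed, by some
  -- possibly different behavior.
  have key : P'.Safe ∧ ∃ A', ResPi.Typed Γ P' A' := by
    induction hred with
    | refl => exact ⟨hsafe, A, htyped⟩
    | tail _ h ih =>
      obtain ⟨L, h⟩ := h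
      obtain ⟨hs, A', ht⟩ := ih
      obtain ⟨⟨T', -, ht'⟩, hs'⟩ := h.typed ht
      exact ⟨hs' hs, T', ht'⟩
  exact key.1
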